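/- Let $\alpha_0,\alpha_1,\alpha_2,\alpha_3\in\mathbb C$ and let $A_5^{(2)}(\alpha_j)_{0\le j\le 3}$ be the system ($'=d/dt$) $$\begin{aligned} tq_1'&=2q_1^2p_1-q_1^2+(\alpha_0+\alpha_1+\alpha_3)q_1-t+4tp_2+2q_1q_2p_2,\\ tp_1'&=-2q_1p_1^2+2q_1p_1-(\alpha_0+\alpha_1+\alpha_3)p_1+\alpha_0-2p_1q_2p_2,\\ tq_2'&=2q_2^2p_2-q_2^2+(\alpha_0+\alpha_1+\alpha_3)q_2-t+4tp_1+2q_1p_1q_2,\\ tp_2'&=-2q_2p_2^2+2q_2p_2-(\alpha_0+\alpha_1+\alpha_3)p_2+\alpha_1-2q_1p_1p_2, \end{aligned}\qquad \alpha_0+\alpha_1+2\alpha_2+\alpha_3=\tfrac12 .$$ Its Bäcklund transformations are the compositions of the following maps of $(q_1,p_1,q_2,p_2;\alpha_0,\alpha_1,\alpha_2,\alpha_3)$, which carry solutions to solutions for the new parameters: $$\begin{aligned} s_0&:\ \Bigl(q_1+\tfrac{\alpha_0}{p_1},p_1,q_2,p_2;-\alpha_0,\alpha_1,\alpha_2+\alpha_0,\alpha_3\Bigr),\\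 s_1&:\ \Bigl(q_1,p_1,q_2+\tfrac{\alpha_1}{p_2},p_2;\alpha_0,-\alpha_1,\alpha_2+\alpha_1,\alpha_3\Bigr),\\ s_2&:\ \Bigl(q_1,p_1-\tfrac{\alpha_2q_2}{q_1q_2+t},q_2,p_2-\tfrac{\alpha_2q_1}{q_1q_2+t};\alpha_0+\alpha_2,\alpha_1+\alpha_2,-\alpha_2,\alpha_3+2\alpha_2\Bigr),\\ s_3&:\ \Bigl(q_1+\tfrac{\alpha_3}{p_1+p_2-1},p_1,q_2+\tfrac{\alpha_3}{p_1+p_2-1},p_2;\alpha_0,\alpha_1,\alpha_2+\alpha_3,-\alpha_3\Bigr),\\ \pi&:\ (q_2,p_2,q_1,p_1;\alpha_1,\alpha_0,\alpha_2,\alpha_3), \end{aligned}$$ where $s_0,s_1,s_2,s_3$ is understood to be the identity if $p_1\equiv0$, $p_2\equiv0$, $q_1q_2+t\equiv0$, $p_1+p_2-1\equiv0$, respectively. The shift operators are $T_0=\pi s_2s_3s_2s_1s_0$, $T_1=s_0T_0s_0$, $T_2=s_2T_0s_2$ (the rightmost factor acts first). Suppose that $(q_1,p_1,q_2,p_2)\in\mathbb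 C(t)^4$ is a rational solution of $A_5^{(2)}(\alpha_j)_{0\le j\le 3}$. Then: (1) There is a Bäcklund transformation that carries it to a rational solution whose parameters satisfy $-2\alpha_0+\alpha_3\in\mathbb Z$ and $-2\alpha_1+\alpha_3\in\mathbb Z$, and that can be chosen so that a product of the shift operators $T_0,T_1,T_2$ and their inverses then carries this solution to a rational solution whose parameters satisfy $-2\alpha_0+\alpha_3=-2\alpha_1+\alpha_3=0$, that is, $\alpha_0=\alpha_1=\alpha_3/2$. In particular, some Bäcklund transformation brings the parameters to $\alpha_0=\alpha_1=\alpha_3/2$. (2) Whenever a Bäcklund transformation has carried the given solution to parameters for which $-2\alpha_0+\alpha_3$ and $-2\alpha_1+\alpha_3$ are integers of the same parity, a product of shift operators and their inverses brings the result to a rational solution with $\alpha_0=\alpha_1=\alpha_3/2$. -/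

import Mathlib

namespace Sasano

/-- The derivative `d/dt` of a rational function: the quotient rule applied to its reduced
numerator and denominator. -/
noncomputable def ratDeriv (f : RatFunc ℂ) : RatFunc ℂ :=
  algebraMap (Polynomial ℂ) (RatFunc ℂ)
      (Polynomial.derivative f.num * f.denom - f.num * Polynomial.derivative f.denom) /
    algebraMap (Polynomial ℂ) (RatFunc ℂ) (f.denom ^ 2)

/-- The independent variable `t`. -/
noncomputable abbrev t : RatFunc ℂ := RatFunc.X

/-- The constant rational function with value `a`. -/
noncomputable abbrev const (a : ℂ) : RatFunc ℂ := RatFunc.C a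

/-- A tuple `(q₁, p₁, q₂, p₂; α₀, α₁, α₂, α₃)` of four rational functions of `t` and four complex
parameters. -/
structure State where
  q₁ : RatFunc ℂ
  p₁ : RatFunc ℂ
  q₂ : RatFunc ℂ
  p₂ : RatFunc ℂ
  α₀ : ℂ
  α₁ : ℂ
  α₂ : ℂ
  α₃ : ℂ

/-- `(q₁, p₁, q₂, p₂)` is a rational solution of the Sasano system of type `A₅⁽²⁾` with parameters
`(α₀, α₁, α₂, α₃)`. The normalization of the parameters is part of the system. -/
structure IsRationalSolution (x : State) : Prop where
  eq_q₁ : t * ratDeriv x.q₁ = 2 * x.q₁ ^ 2 * x.p₁ - x.q₁ ^ 2 + const (x.α₀ + x.α₁ + x.α₃) * x.q₁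
    - t + 4 * t * x.p₂ + 2 * x.q₁ * x.q₂ * x.p₂
  eq_p₁ : t * ratDeriv x.p₁ = -2 * x.q₁ * x.p₁ ^ 2 + 2 * x.q₁ * x.p₁
    - const (x.α₀ + x.α₁ + x.α₃) * x.p₁ + const x.α₀ - 2 * x.p₁ * x.q₂ * x.p₂
  eq_q₂ : t * ratDeriv x.q₂ = 2 * x.q₂ ^ 2 * x.p₂ - x.q₂ ^ 2 + const (x.α₀ + x.α₁ + x.α₃) * x.q₂
    - t + 4 * t * x.p₁ + 2 * x.q₁ * x.p₁ * x.q₂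
  eq_p₂ : t * ratDeriv x.p₂ = -2 * x.q₂ * x.p₂ ^ 2 + 2 * x.q₂ * x.p₂
    - const (x.α₀ + x.α₁ + x.α₃) * x.p₂ + const x.α₁ - 2 * x.q₁ * x.p₁ * x.p₂
  normalization : x.α₀ + x.α₁ + 2 * x.α₂ + x.α₃ = 1 / 2

open scoped Classical in
/-- The transformation `s₀`; the identity if `p₁ ≡ 0`. -/
noncomputable def s₀ (x : State) : State :=
  if x.p₁ = 0 then x else
    { q₁ := x.q₁ + const x.α₀ / x.p₁, p₁ := x.p₁, q₂ := x.q₂, p₂ := x.p₂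
      α₀ := -x.α₀, α₁ := x.α₁, α₂ := x.α₂ + x.α₀, α₃ := x.α₃ }

open scoped Classical in
/-- The transformation `s₁`; the identity if `p₂ ≡ 0`. -/
noncomputable def s₁ (x : State) : State :=
  if x.p₂ = 0 then x else
    { q₁ := x.q₁, p₁ := x.p₁, q₂ := x.q₂ + const x.α₁ / x.p₂, p₂ := x.p₂
      α₀ := x.α₀, α₁ := -x.α₁, α₂ := x.α₂ + x.α₁, α₃ := x.α₃ }

open scoped Classical in
/-- The transformation `s₂`; the identity if `q₁ q₂ + t ≡ 0`. -/
noncomputable def s₂ (x : State) : State :=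
  if x.q₁ * x.q₂ + t = 0 then x else
    { q₁ := x.q₁, p₁ := x.p₁ - const x.α₂ * x.q₂ / (x.q₁ * x.q₂ + t)
      q₂ := x.q₂, p₂ := x.p₂ - const x.α₂ * x.q₁ / (x.q₁ * x.q₂ + t)
      α₀ := x.α₀ + x.α₂, α₁ := x.α₁ + x.α₂, α₂ := -x.α₂, α₃ := x.α₃ + 2 * x.α₂ }

open scoped Classical in
/-- The transformation `s₃`; the identity if `p₁ + p₂ - 1 ≡ 0`. -/
noncomputable def s₃ (x : State) : State :=
  if x.p₁ + x.p₂ - 1 = 0 then x else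
    { q₁ := x.q₁ + const x.α₃ / (x.p₁ + x.p₂ - 1), p₁ := x.p₁
      q₂ := x.q₂ + const x.α₃ / (x.p₁ + x.p₂ - 1), p₂ := x.p₂
      α₀ := x.α₀, α₁ := x.α₁, α₂ := x.α₂ + x.α₃, α₃ := -x.α₃ }

/-- The transformation `π`. -/
def swap (x : State) : State :=
  { q₁ := x.q₂, p₁ := x.p₂, q₂ := x.q₁, p₂ := x.p₁
    α₀ := x.α₁, α₁ := x.α₀, α₂ := x.α₂, α₃ := x.α₃ }

/-- The generators `s₀, s₁, s₂, s₃, π` of the group of Bäcklund transformations. -/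
inductive Generator where
  | s0 | s1 | s2 | s3 | pi

/-- The action of a generator on solutions and parameters. -/
noncomputable def Generator.act : Generator → State → State
  | .s0 => s₀
  | .s1 => s₁
  | .s2 => s₂
  | .s3 => s₃
  | .pi => swap

/-- The Bäcklund transformation given by a word in the generators. The product is composition of
maps, so the last letter acts first. The generators are involutions on solutions, so words describe
all elements of the group that they generate. -/
noncomputable def act (w : List Generator) (x : State) : State :=
  w.foldr Generator.act x

open Generator in
/-- `T₀ = π s₂ s₃ s₂ s₁ s₀`. -/
def T₀ : List Generator := [pi, s2, s3, s2, s1, s0]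

/-- `T₁ = s₀ T₀ s₀`. -/
def T₁ : List Generator := [Generator.s0] ++ T₀ ++ [Generator.s0]

/-- `T₂ = s₂ T₀ s₂`. -/
def T₂ : List Generator := [Generator.s2] ++ T₀ ++ [Generator.s2]

/-- The Bäcklund transformations `T₀^{±1}, T₁^{±1}, T₂^{±1}`, as words in the generators. The
inverse of a word is the reversed word, because the generators are involutions. -/
inductive Shift where
  | T0 | T1 | T2 | T0inv | T1inv | T2inv

/-- The word in the generators `s₀, s₁, s₂, s₃, π` of a shift operator or of its inverse. -/
def Shift.word : Shift → List Generator
  | .T0 => T₀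
  | .T1 => T₁
  | .T2 => T₂
  | .T0inv => T₀.reverse
  | .T1inv => T₁.reverse
  | .T2inv => T₂.reverse

/-- The action of a product of shift operators and their inverses; the last factor acts first. -/
noncomputable def shiftAct (v : List Shift) (x : State) : State :=
  act (v.flatMap Shift.word) x

end Sasano

/-! Write H = q₁p₁ + q₂p₂. A local analysis shows that q₁, q₂ and H are regular at 0 and ∞ and have
at most simple poles elsewhere (`HSystem.exists_E`), and that at those poles the residues of q₁, q₂
and 2H with respect to dt/t are integers (`HSystem.leading_finite`). By the residue theorem for f
dt/t (`exists_int_sub_eq`), the values of each of these functions at ∞ and at 0 differ by an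
integer.

At ∞ the values of q₁, q₂, 2H are forced to be α₃ − 2α₀, α₃ − 2α₁, α₃ − α₀ − α₁
(`HSystem.value_infinity`); at 0 there are six possibilities (`HSystem.value_zero`). If all values
at 0 vanish, the first two numbers are integers, and the third makes their sum even. Each other
possibility is brought to integers of equal parity by at most two of the reflections s₀, …, s₃
(`exists_act_even_sub`).

T₀ and T₁ fix α₃ and translate (α₀, α₁) by (1/2, 1/2) and (−1/2, 1/2), so they move (−2α₀ + α₃, −2α₁
+ α₃) by (−1, −1) and (1, −1). These vectors generate the lattice of integer pairs of equal parity,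
so every such pair reaches (0, 0) (`exists_shiftAct_eq_zero`); T₂ is not needed. The action on
parameters is linear throughout, because a reflection degenerates to the identity only when its
parameter is zero. -/

namespace Sasano

open Polynomial

/-! ### The derivative of rational functions -/

/-- The quotient rule holds for every fraction that represents a rational function. -/
theorem ratDeriv_div (N D : ℂ[X]) (hD : D ≠ 0) :
    ratDeriv (algebraMap ℂ[X] (RatFunc ℂ) N / algebraMap ℂ[X] (RatFunc ℂ) D) =
      algebraMap ℂ[X] (RatFunc ℂ) (derivative N * D - N * derivative D) /
        algebraMap ℂ[X] (RatFunc ℂ) (D ^ 2) := by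
  have key : ∀ n d : ℂ[X], n * D = N * d →
      (derivative n * d - n * derivative d) * D ^ 2 =
        (derivative N * D - N * derivative D) * d ^ 2 := by
    intro n d h
    have h' := congrArg derivative h
    simp only [derivative_mul] at h'
    linear_combination (d * D) * h' - (derivative d * D + d * derivative D) * h
  unfold ratDeriv
  rw [div_eq_div_iff (RatFunc.algebraMap_ne_zero (pow_ne_zero 2 (RatFunc.denom_ne_zero _)))
    (RatFunc.algebraMap_ne_zero (pow_ne_zero 2 hD)), ← map_mul, ← map_mul,
    key _ _ ((RatFunc.num_mul_eq_mul_denom_iff hD).2 rfl)]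

theorem exists_eq_div (f : RatFunc ℂ) : ∃ N D : ℂ[X], D ≠ 0 ∧
    f = algebraMap ℂ[X] (RatFunc ℂ) N / algebraMap ℂ[X] (RatFunc ℂ) D :=
  ⟨f.num, f.denom, f.denom_ne_zero, (RatFunc.num_div_denom f).symm⟩

theorem ratDeriv_add (f g : RatFunc ℂ) : ratDeriv (f + g) = ratDeriv f + ratDeriv g := by
  obtain ⟨N, D, hD, rfl⟩ := exists_eq_div f
  obtain ⟨M, E, hE, rfl⟩ := exists_eq_div g
  have hD' := RatFunc.algebraMap_ne_zero hD
  have hE' := RatFunc.algebraMap_ne_zero hE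
  rw [div_add_div _ _ hD' hE', ← map_mul, ← map_mul, ← map_mul, ← map_add,
    ratDeriv_div _ _ (mul_ne_zero hD hE), ratDeriv_div _ _ hD, ratDeriv_div _ _ hE]
  simp only [derivative_mul, map_mul, map_add, map_sub, map_pow]
  field_simp
  ring

theorem ratDeriv_mul (f g : RatFunc ℂ) :
    ratDeriv (f * g) = ratDeriv f * g + f * ratDeriv g := by
  obtain ⟨N, D, hD, rfl⟩ := exists_eq_div f
  obtain ⟨M, E, hE, rfl⟩ := exists_eq_div g
  have hD' := RatFunc.algebraMap_ne_zero hD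
  have hE' := RatFunc.algebraMap_ne_zero hE
  rw [div_mul_div_comm, ← map_mul, ← map_mul,
    ratDeriv_div _ _ (mul_ne_zero hD hE), ratDeriv_div _ _ hD, ratDeriv_div _ _ hE]
  simp only [derivative_mul, map_mul, map_add, map_sub, map_pow]
  field_simp
  ring

theorem ratDeriv_algebraMap (N : ℂ[X]) :
    ratDeriv (algebraMap ℂ[X] (RatFunc ℂ) N) = algebraMap ℂ[X] (RatFunc ℂ) (derivative N) := by
  simpa using ratDeriv_div N 1 one_ne_zero

@[simp] theorem ratDeriv_const (a : ℂ) : ratDeriv (const a) = 0 := by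
  simpa [RatFunc.algebraMap_C] using ratDeriv_algebraMap (Polynomial.C a)

@[simp] theorem ratDeriv_t : ratDeriv t = 1 := by
  simpa [RatFunc.algebraMap_X] using ratDeriv_algebraMap Polynomial.X

theorem ratDeriv_one : ratDeriv 1 = 0 := by
  simpa using ratDeriv_const 1

theorem ratDeriv_neg (f : RatFunc ℂ) : ratDeriv (-f) = -ratDeriv f := by
  have h := ratDeriv_mul (const (-1)) f
  rw [ratDeriv_const] at h
  simpa using h

theorem ratDeriv_sub (f g : RatFunc ℂ) : ratDeriv (f - g) = ratDeriv f - ratDeriv g := by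
  rw [sub_eq_add_neg, ratDeriv_add, ratDeriv_neg, sub_eq_add_neg]

theorem ratDeriv_div' (f g : RatFunc ℂ) (hg : g ≠ 0) :
    ratDeriv (f / g) = (ratDeriv f * g - f * ratDeriv g) / g ^ 2 := by
  have h := ratDeriv_mul (f / g) g
  rw [div_mul_cancel₀ _ hg] at h
  rw [h]
  field_simp
  ring

/-! ### Bäcklund transformations carry solutions to solutions -/

theorem IsRationalSolution.swap {x : State} (hx : IsRationalSolution x) :
    IsRationalSolution (swap x) := by
  obtain ⟨h1, h2, h3, h4, h5⟩ := hx
  constructor <;> simp only [Sasano.swap, map_add] at *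
  · rw [h3]; ring
  · rw [h4]; ring
  · rw [h1]; ring
  · rw [h2]; ring
  · rw [← h5]; ring

theorem IsRationalSolution.s₀ {x : State} (hx : IsRationalSolution x) :
    IsRationalSolution (s₀ x) := by
  unfold Sasano.s₀
  split_ifs with h
  · exact hx
  obtain ⟨h1, h2, h3, h4, h5⟩ := hx
  constructor <;> simp only [map_add, map_neg] at *
  · rw [ratDeriv_add, ratDeriv_div' _ _ h, ratDeriv_const]
    field_simp
    linear_combination x.p₁ ^ 2 * h1 - const x.α₀ * h2
  · field_simp
    linear_combination h2
  · field_simp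
    linear_combination h3
  · field_simp
    linear_combination h4
  · linear_combination h5

theorem IsRationalSolution.s₁ {x : State} (hx : IsRationalSolution x) :
    IsRationalSolution (s₁ x) := by
  have h : Sasano.s₁ x = Sasano.swap (Sasano.s₀ (Sasano.swap x)) := by
    unfold Sasano.s₁ Sasano.s₀ Sasano.swap
    dsimp only
    split_ifs <;> rfl
  rw [h]
  exact hx.swap.s₀.swap

theorem IsRationalSolution.s₂ {x : State} (hx : IsRationalSolution x) :
    IsRationalSolution (s₂ x) := by
  unfold Sasano.s₂
  split_ifs with h
  · exact hx
  obtain ⟨h1, h2, h3, h4, h5⟩ := hx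
  obtain ⟨S, hS⟩ : ∃ S, S = x.q₁ * x.q₂ + t := ⟨_, rfl⟩
  rw [← hS] at h ⊢
  have hD : ratDeriv S = ratDeriv x.q₁ * x.q₂ + x.q₁ * ratDeriv x.q₂ + 1 := by
    rw [hS, ratDeriv_add, ratDeriv_mul, ratDeriv_t]
  have ht : t = S - x.q₁ * x.q₂ := by rw [hS]; ring
  -- The normalization enters here: with a = α₀ + α₁ + α₃ it reads 2a + 4α₂ = 1, which matches the
  -- term t' = 1 in the derivative of S.
  have h6 : RatFunc.C x.α₃ = 1 / 2 - RatFunc.C x.α₀ - RatFunc.C x.α₁ - 2 * RatFunc.C x.α₂ := by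
    have h := congrArg RatFunc.C h5
    simp only [map_add, map_mul, map_div₀, map_one, map_ofNat] at h
    linear_combination h
  constructor <;> simp only [map_add, map_mul, map_ofNat, h6] at *
  · rw [ht] at h1 ⊢
    field_simp
    linear_combination 2 * S * h1
  · rw [ratDeriv_sub, ratDeriv_div' _ _ h, ratDeriv_mul, ratDeriv_const, hD]
    rw [ht] at h1 h2 h3 ⊢
    field_simp
    linear_combination 2 * S ^ 2 * h2 - 2 * const x.α₂ * (S - x.q₁ * x.q₂) * h3
      + 2 * const x.α₂ * x.q₂ ^ 2 * h1
  · rw [ht] at h3 ⊢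
    field_simp
    linear_combination 2 * S * h3
  · rw [ratDeriv_sub, ratDeriv_div' _ _ h, ratDeriv_mul, ratDeriv_const, hD]
    rw [ht] at h1 h3 h4 ⊢
    field_simp
    linear_combination 2 * S ^ 2 * h4 - 2 * const x.α₂ * (S - x.q₁ * x.q₂) * h1
      + 2 * const x.α₂ * x.q₁ ^ 2 * h3
  · linear_combination h5

theorem IsRationalSolution.s₃ {x : State} (hx : IsRationalSolution x) :
    IsRationalSolution (s₃ x) := by
  unfold Sasano.s₃
  split_ifs with h
  · exact hx
  obtain ⟨h1, h2, h3, h4, h5⟩ := hx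
  constructor <;> simp only [map_add, map_neg] at *
  · rw [ratDeriv_add, ratDeriv_div' _ _ h, ratDeriv_const, ratDeriv_sub, ratDeriv_add, ratDeriv_one]
    field_simp
    linear_combination (x.p₁ + x.p₂ - 1) ^ 2 * h1 - const x.α₃ * (h2 + h4)
  · field_simp
    linear_combination (x.p₁ + x.p₂ - 1) * h2
  · rw [ratDeriv_add, ratDeriv_div' _ _ h, ratDeriv_const, ratDeriv_sub, ratDeriv_add, ratDeriv_one]
    field_simp
    linear_combination (x.p₁ + x.p₂ - 1) ^ 2 * h3 - const x.α₃ * (h2 + h4)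
  · field_simp
    linear_combination (x.p₁ + x.p₂ - 1) * h4
  · linear_combination h5


/-! ### The action on the parameters -/

theorem const_eq_zero {a : ℂ} : const a = 0 ↔ a = 0 :=
  map_eq_zero RatFunc.C

/-- If p₁ ≡ 0, only α₀ survives in the p₁-equation. This and the next two lemmas make the identity
convention agree with the generic action on the parameters. -/
theorem IsRationalSolution.α₀_eq_zero {x : State} (hx : IsRationalSolution x) (h : x.p₁ = 0) :
    x.α₀ = 0 := by
  have h2 := hx.eq_p₁
  have h0 : ratDeriv 0 = 0 := by simpa using ratDeriv_const 0
  rw [h, h0] at h2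
  simpa using h2.symm

/-- For S = q₁q₂ + t, the system and the normalization give tS' = S(4H − q₁ − q₂ + 1 − 4α₂) + 4α₂t,
so S ≡ 0 leaves 4α₂t = 0. -/
theorem IsRationalSolution.α₂_eq_zero {x : State} (hx : IsRationalSolution x)
    (h : x.q₁ * x.q₂ + t = 0) : x.α₂ = 0 := by
  obtain ⟨h1, h2, h3, h4, h5⟩ := hx
  have hD : ratDeriv x.q₁ * x.q₂ + x.q₁ * ratDeriv x.q₂ + 1 = 0 := by
    rw [← ratDeriv_mul, ← ratDeriv_t, ← ratDeriv_add, h]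
    simpa using ratDeriv_const 0
  have h6 : RatFunc.C x.α₃ = 1 / 2 - RatFunc.C x.α₀ - RatFunc.C x.α₁ - 2 * RatFunc.C x.α₂ := by
    have h := congrArg RatFunc.C h5
    simp only [map_add, map_mul, map_div₀, map_one, map_ofNat] at h
    linear_combination h
  simp only [map_add] at h1 h3
  rw [h6] at h1 h3
  have ht : t ≠ 0 := RatFunc.X_ne_zero
  have key : t * const x.α₂ = 0 := by
    linear_combination (t * hD - x.q₂ * h1 - x.q₁ * h3
      - (2 * x.q₁ * x.p₁ - x.q₁ + 1 - 4 * const x.α₂ + 4 * x.q₂ * x.p₂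
        - x.q₂ + 2 * x.q₁ * x.p₁) * h) / 4
  exact const_eq_zero.1 ((mul_eq_zero.1 key).resolve_left ht)

/-- The sum of the p-equations is t(p₁ + p₂)' = −(p₁ + p₂ − 1)(2H + α₀ + α₁ + α₃) − α₃. -/
theorem IsRationalSolution.α₃_eq_zero {x : State} (hx : IsRationalSolution x)
    (h : x.p₁ + x.p₂ - 1 = 0) : x.α₃ = 0 := by
  obtain ⟨h1, h2, h3, h4, h5⟩ := hx
  have hD : ratDeriv x.p₁ + ratDeriv x.p₂ = 0 := by
    rw [← ratDeriv_add, show x.p₁ + x.p₂ = 1 by linear_combination h, ratDeriv_one]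
  simp only [map_add] at h2 h4
  refine const_eq_zero.1 ?_
  linear_combination (-t) * hD + h2 + h4 - (2 * x.q₁ * x.p₁ + 2 * x.q₂ * x.p₂
    + const x.α₀ + const x.α₁ + const x.α₃) * h

theorem IsRationalSolution.params_s₀ {x : State} (hx : IsRationalSolution x) :
    (Sasano.s₀ x).α₀ = -x.α₀ ∧ (Sasano.s₀ x).α₁ = x.α₁ ∧ (Sasano.s₀ x).α₂ = x.α₂ + x.α₀ ∧
      (Sasano.s₀ x).α₃ = x.α₃ := by
  unfold Sasano.s₀
  split_ifs with h
  · simp [hx.α₀_eq_zero h]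
  · simp

theorem IsRationalSolution.params_s₁ {x : State} (hx : IsRationalSolution x) :
    (Sasano.s₁ x).α₀ = x.α₀ ∧ (Sasano.s₁ x).α₁ = -x.α₁ ∧ (Sasano.s₁ x).α₂ = x.α₂ + x.α₁ ∧
      (Sasano.s₁ x).α₃ = x.α₃ := by
  unfold Sasano.s₁
  split_ifs with h
  · have h0 : x.α₁ = 0 := hx.swap.α₀_eq_zero h
    simp [h0]
  · simp

theorem IsRationalSolution.params_s₂ {x : State} (hx : IsRationalSolution x) :
    (Sasano.s₂ x).α₀ = x.α₀ + x.α₂ ∧ (Sasano.s₂ x).α₁ = x.α₁ + x.α₂ ∧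
      (Sasano.s₂ x).α₂ = -x.α₂ ∧ (Sasano.s₂ x).α₃ = x.α₃ + 2 * x.α₂ := by
  unfold Sasano.s₂
  split_ifs with h
  · simp [hx.α₂_eq_zero h]
  · simp

theorem IsRationalSolution.params_s₃ {x : State} (hx : IsRationalSolution x) :
    (Sasano.s₃ x).α₀ = x.α₀ ∧ (Sasano.s₃ x).α₁ = x.α₁ ∧ (Sasano.s₃ x).α₂ = x.α₂ + x.α₃ ∧
      (Sasano.s₃ x).α₃ = -x.α₃ := by
  unfold Sasano.s₃
  split_ifs with h
  · simp [hx.α₃_eq_zero h]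
  · simp

theorem IsRationalSolution.act {x : State} (hx : IsRationalSolution x) :
    ∀ w : List Generator, IsRationalSolution (act w x)
  | [] => hx
  | .s0 :: w => (hx.act w).s₀
  | .s1 :: w => (hx.act w).s₁
  | .s2 :: w => (hx.act w).s₂
  | .s3 :: w => (hx.act w).s₃
  | .pi :: w => (hx.act w).swap

theorem act_append (v w : List Generator) (x : State) : act (v ++ w) x = act v (act w x) := by
  simp [act]

/-- A word translates the parameters `α₀` and `α₁` of every solution by `i / 2` and `j / 2` and
fixes `α₃`. -/
def Translates (w : List Generator) (i j : ℤ) : Prop :=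
  ∀ x, IsRationalSolution x → (act w x).α₀ = x.α₀ + i / 2 ∧ (act w x).α₁ = x.α₁ + j / 2 ∧
    (act w x).α₃ = x.α₃

theorem translates_T₀ : Translates T₀ 1 1 := by
  intro x hx
  have h5 := hx.normalization
  have hx1 := hx.s₀
  have hx2 := hx1.s₁
  have hx3 := hx2.s₂
  have hx4 := hx3.s₃
  change (swap (s₂ (s₃ (s₂ (s₁ (s₀ x)))))).α₀ = _ ∧ (swap (s₂ (s₃ (s₂ (s₁ (s₀ x)))))).α₁ = _ ∧
    (swap (s₂ (s₃ (s₂ (s₁ (s₀ x)))))).α₃ = _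
  simp only [swap, hx4.params_s₂, hx3.params_s₃, hx2.params_s₂, hx1.params_s₁, hx.params_s₀]
  push_cast
  refine ⟨?_, ?_, ?_⟩
  · linear_combination h5
  · linear_combination h5
  · ring

/-- Only the parameters matter later, so the reversed word is evaluated directly; that it inverts T₀
on solutions is never used. -/
theorem translates_T₀_reverse : Translates T₀.reverse (-1) (-1) := by
  intro x hx
  have h5 := hx.normalization
  have hx1 := hx.swap
  have hx2 := hx1.s₂
  have hx3 := hx2.s₃
  have hx4 := hx3.s₂
  have hx5 := hx4.s₁
  change (s₀ (s₁ (s₂ (s₃ (s₂ (swap x)))))).α₀ = _ ∧ (s₀ (s₁ (s₂ (s₃ (s₂ (swap x)))))).α₁ = _ ∧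
    (s₀ (s₁ (s₂ (s₃ (s₂ (swap x)))))).α₃ = _
  simp only [hx5.params_s₀, hx4.params_s₁, hx3.params_s₂, hx2.params_s₃, hx1.params_s₂]
  simp only [swap]
  push_cast
  refine ⟨?_, ?_, ?_⟩
  · linear_combination -h5
  · linear_combination -h5
  · ring

/-- On (α₀, α₁, α₃) the map s₀ only changes the sign of α₀, so conjugation reverses the first
component of the translation. -/
theorem Translates.conj_s0 {w : List Generator} {i j : ℤ} (h : Translates w i j) :
    Translates ([Generator.s0] ++ w ++ [Generator.s0]) (-i) j := by
  intro x hx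
  rw [act_append, act_append]
  have hx1 := hx.s₀
  have hx2 := hx1.act w
  obtain ⟨h0, h1, h3⟩ := h _ hx1
  change (s₀ (Sasano.act w (s₀ x))).α₀ = _ ∧ (s₀ (Sasano.act w (s₀ x))).α₁ = _ ∧
    (s₀ (Sasano.act w (s₀ x))).α₃ = _
  simp only [hx2.params_s₀, h0, h1, h3, hx.params_s₀]
  push_cast
  refine ⟨?_, trivial, trivial⟩
  ring

theorem translates_T₁ : Translates T₁ (-1) 1 :=
  translates_T₀.conj_s0

theorem translates_T₁_reverse : Translates T₁.reverse 1 (-1) :=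
  translates_T₀_reverse.conj_s0

theorem exists_shiftAct_translate (σ σ' : Shift) (i j : ℤ) (h : Translates σ.word i j)
    (h' : Translates σ'.word (-i) (-j)) (k : ℤ) {x : State} (hx : IsRationalSolution x) :
    ∃ v : List Shift, (shiftAct v x).α₀ = x.α₀ + k * i / 2 ∧
      (shiftAct v x).α₁ = x.α₁ + k * j / 2 ∧ (shiftAct v x).α₃ = x.α₃ := by
  have hcons : ∀ (τ : Shift) (v : List Shift), shiftAct (τ :: v) x = act τ.word (shiftAct v x) := by
    intro τ v
    simp [shiftAct, act_append]
  induction k using Int.induction_on with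
  | zero => exact ⟨[], by simp [shiftAct, act]⟩
  | succ k ih =>
    obtain ⟨v, h0, h1, h3⟩ := ih
    obtain ⟨g0, g1, g3⟩ := h _ (hx.act (v.flatMap Shift.word))
    refine ⟨σ :: v, ?_⟩
    rw [hcons]
    change (Sasano.act _ (Sasano.act _ x)).α₀ = _ ∧ (Sasano.act _ (Sasano.act _ x)).α₁ = _ ∧
      (Sasano.act _ (Sasano.act _ x)).α₃ = _
    simp only [shiftAct] at h0 h1 h3
    rw [g0, g1, g3, h0, h1, h3]
    push_cast
    refine ⟨?_, ?_, ?_⟩ <;> ring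
  | pred k ih =>
    obtain ⟨v, h0, h1, h3⟩ := ih
    obtain ⟨g0, g1, g3⟩ := h' _ (hx.act (v.flatMap Shift.word))
    refine ⟨σ' :: v, ?_⟩
    rw [hcons]
    change (Sasano.act _ (Sasano.act _ x)).α₀ = _ ∧ (Sasano.act _ (Sasano.act _ x)).α₁ = _ ∧
      (Sasano.act _ (Sasano.act _ x)).α₃ = _
    simp only [shiftAct] at h0 h1 h3
    rw [g0, g1, g3, h0, h1, h3]
    push_cast
    refine ⟨?_, ?_, ?_⟩ <;> ring

/-- If `-2α₀ + α₃` and `-2α₁ + α₃` are integers of the same parity, then a product of shift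
operators makes both of them vanish. -/
theorem exists_shiftAct_eq_zero {x : State} (hx : IsRationalSolution x) {m n : ℤ}
    (hm : -2 * x.α₀ + x.α₃ = m) (hn : -2 * x.α₁ + x.α₃ = n) (hmn : Even (m - n)) :
    ∃ v : List Shift, IsRationalSolution (shiftAct v x) ∧
      -2 * (shiftAct v x).α₀ + (shiftAct v x).α₃ = 0 ∧
      -2 * (shiftAct v x).α₁ + (shiftAct v x).α₃ = 0 := by
  obtain ⟨k, hk⟩ := hmn
  -- The exponents solve a linear system: with m − n = 2k, T₀^(n+k) followed by T₁^(−k) adds m/2 to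
  -- α₀ and n/2 to α₁.
  obtain ⟨v, h0, h1, h3⟩ := exists_shiftAct_translate .T0 .T0inv 1 1 translates_T₀
    translates_T₀_reverse (n + k) hx
  obtain ⟨w, g0, g1, g3⟩ := exists_shiftAct_translate .T1 .T1inv (-1) 1 translates_T₁
    translates_T₁_reverse (-k) (x := shiftAct v x) (hx.act _)
  have hwv : shiftAct (w ++ v) x = shiftAct w (shiftAct v x) := by
    simp [shiftAct, act_append]
  have hk' : (m : ℂ) - n = k + k := by exact_mod_cast hk
  refine ⟨w ++ v, hx.act _, ?_, ?_⟩
  · rw [hwv, g0, g3, h0, h3]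
    push_cast
    linear_combination hm + hk'
  · rw [hwv, g1, g3, h1, h3]
    push_cast
    linear_combination hn


/-! ### Local expansions of rational functions -/

/-- A place of `ℂ(t)` at which the derivation `t d/dt` raises the order of a pole by `δ`: the
relation `V f z` says that `f` is regular at the place with value `z`, `τ` is a local
parameter, and `t` has a pole of order `e` with leading coefficient `T`. -/
structure Place where
  V : RatFunc ℂ → ℂ → Prop
  τ : RatFunc ℂ
  δ : ℤ
  e : ℤ
  γ : ℂ
  T : ℂ
  τ_ne_zero : τ ≠ 0
  value_const : ∀ a, V (const a) a
  value_add : ∀ {f g z w}, V f z → V g w → V (f + g) (z + w)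
  value_mul : ∀ {f g z w}, V f z → V g w → V (f * g) (z * w)
  value_unique : ∀ {f z w}, V f z → V f w → z = w
  value_τ : V τ 0
  value_div : ∀ {f}, V f 0 → ∃ w, V (f / τ) w
  exists_order : ∀ {f}, f ≠ 0 → ∃ (k : ℤ) (z : ℂ), z ≠ 0 ∧ V (τ ^ k * f) z
  value_deriv : ∀ {f z}, V f z → V (τ ^ δ * (t * ratDeriv f)) 0
  value_deriv_τ : V (τ ^ δ * (t * ratDeriv τ / τ)) γ
  value_t : V (τ ^ e * t) T
  T_ne_zero : T ≠ 0
  δ_nonneg : 0 ≤ δ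
  δ_le_one : δ ≤ 1
  e_le_one : e ≤ 1

namespace Place

variable (P : Place)

/-- `P.E k f z` says that `f` has a pole of order at most `k` at `P`, and that `z` is the
coefficient of the `-k`-th power of the local parameter in its expansion. -/
def E (k : ℤ) (f : RatFunc ℂ) (z : ℂ) : Prop := P.V (P.τ ^ k * f) z

variable {P} {k l n : ℤ} {f g : RatFunc ℂ} {z w : ℂ}

theorem E.unique (hf : P.E k f z) (hg : P.E k f w) : z = w := P.value_unique hf hg

theorem E.congr (hf : P.E k f z) (h : f = g) : P.E k g z := h ▸ hf

theorem E.add (hf : P.E k f z) (hg : P.E k g w) : P.E k (f + g) (z + w) := by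
  unfold E
  rw [mul_add]
  exact P.value_add hf hg

theorem E.mul (hf : P.E k f z) (hg : P.E l g w) (h : n = k + l := by omega) :
    P.E n (f * g) (z * w) := by
  unfold E
  rw [h, zpow_add₀ P.τ_ne_zero, mul_mul_mul_comm]
  exact P.value_mul hf hg

theorem E_const (a : ℂ) : P.E 0 (const a) a := by
  unfold E
  rw [zpow_zero, one_mul]
  exact P.value_const a

theorem E_t : P.E P.e t P.T := P.value_t

theorem E.const_mul (a : ℂ) (hf : P.E k f z) : P.E k (const a * f) (a * z) :=
  (P.E_const a).mul hf

theorem E.neg (hf : P.E k f z) : P.E k (-f) (-z) := by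
  have h := hf.const_mul (-1)
  rw [neg_one_mul] at h
  exact h.congr (by simp [const])

theorem E.sub (hf : P.E k f z) (hg : P.E k g w) : P.E k (f - g) (z - w) := by
  simpa only [sub_eq_add_neg] using hf.add hg.neg

theorem E.two_mul (hf : P.E k f z) : P.E k (2 * f) (2 * z) :=
  (hf.const_mul 2).congr (by rw [const, map_ofNat])

theorem E.four_mul (hf : P.E k f z) : P.E k (4 * f) (4 * z) :=
  (hf.const_mul 4).congr (by rw [const, map_ofNat])

theorem E_zero : P.E k 0 0 := by
  unfold E
  rw [mul_zero]
  simpa using P.value_const 0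

theorem E.succ (hf : P.E k f z) : P.E (k + 1) f 0 := by
  unfold E
  have h := P.value_mul P.value_τ hf
  rwa [zero_mul, ← mul_assoc, ← zpow_one_add₀ P.τ_ne_zero, add_comm 1 k] at h

/-- This is how subdominant terms disappear: read in a higher order, an expansion has coefficient 0.
The inequality between the orders is left to `omega` by default. -/
theorem E.lift (hf : P.E k f z) (h : k < l := by omega) : P.E l f 0 := by
  obtain ⟨m, rfl⟩ : ∃ m : ℕ, l = k + 1 + m := ⟨(l - k - 1).toNat, by omega⟩
  clear h
  induction m with
  | zero => simpa using hf.succ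
  | succ m ih =>
    have h := ih.succ
    push_cast
    rwa [← add_assoc]

theorem E.le (hf : P.E k f z) (h : k ≤ l := by omega) : ∃ z, P.E l f z := by
  rcases h.eq_or_lt with rfl | h
  · exact ⟨z, hf⟩
  · exact ⟨0, hf.lift⟩

theorem E.pred (hf : P.E k f 0) (h : l = k - 1 := by omega) : ∃ w, P.E l f w := by
  obtain ⟨w, hw⟩ := P.value_div hf
  refine ⟨w, ?_⟩
  unfold E
  rwa [h, zpow_sub_one₀ P.τ_ne_zero, mul_right_comm, ← div_eq_mul_inv]

theorem exists_E (hf : f ≠ 0) : ∃ (k : ℤ) (z : ℂ), z ≠ 0 ∧ P.E k f z := P.exists_order hf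

/-- A function has a pole of order more than `k`, or it has an expansion in order `k`. -/
theorem E_or (P : Place) (k : ℤ) (f : RatFunc ℂ) :
    (∃ z, P.E k f z) ∨ ∃ (l : ℤ) (z : ℂ), k < l ∧ z ≠ 0 ∧ P.E l f z := by
  by_cases hf : f = 0
  · exact Or.inl ⟨0, hf ▸ E_zero⟩
  · obtain ⟨l, z, hz, h⟩ := exists_E (P := P) hf
    rcases le_or_gt l k with hl | hl
    · exact Or.inl h.le
    · exact Or.inr ⟨l, z, hl, hz, h⟩

theorem E.ne_zero (hf : P.E k f z) (hz : z ≠ 0) : f ≠ 0 := by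
  rintro rfl
  exact hz (hf.unique E_zero)

/-- Division of expansions. -/
theorem E.cancel (hf : P.E k f z) (hz : z ≠ 0) (hfg : P.E n (f * g) w)
    (h : n = k + l := by omega) : P.E l g (w / z) := by
  have key : ∀ w', P.E l g w' → w' = w / z := by
    intro w' h'
    rw [eq_div_iff hz, mul_comm]
    exact (hf.mul h').unique hfg
  rcases P.E_or l g with ⟨w', h'⟩ | ⟨m, w', hm, hw', h'⟩
  · rwa [← key w' h']
  -- A pole of `g` of order m > l would give `f * g` a nonzero coefficient in order k + m > n.
  · have h1 := hf.mul h' (n := k + m) rfl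
    have h2 := hfg.lift (l := k + m)
    exact absurd (h1.unique h2) (mul_ne_zero hz hw')

theorem ratDeriv_zpow {f : RatFunc ℂ} (hf : f ≠ 0) (n : ℤ) :
    ratDeriv (f ^ n) = n * f ^ n * (ratDeriv f / f) := by
  induction n using Int.induction_on with
  | zero => simpa using ratDeriv_one
  | succ n ih =>
    rw [zpow_add_one₀ hf, ratDeriv_mul, ih]
    push_cast
    field_simp
  | pred n ih =>
    have h := ratDeriv_mul (f ^ (-(n : ℤ) - 1)) f
    rw [← zpow_add_one₀ hf, sub_add_cancel, ih, zpow_sub_one₀ hf] at h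
    have h' : ratDeriv (f ^ (-(n : ℤ) - 1)) = (((-n : ℤ) : RatFunc ℂ) * f ^ (-n : ℤ) *
      (ratDeriv f / f) - f ^ (-(n : ℤ)) * f⁻¹ * ratDeriv f) / f := by
      rw [eq_div_iff hf, zpow_sub_one₀ hf]; linear_combination -h
    rw [h', zpow_sub_one₀ hf]
    push_cast
    field_simp

/-- Write f = τ^(−k)u with u regular. The derivative of u contributes nothing in order k + δ, and
the logarithmic derivative of τ^(−k) contributes −kγ. -/
theorem E.deriv (hf : P.E k f z) (h : n = k + P.δ := by omega) :
    P.E n (t * ratDeriv f) (-k * P.γ * z) := by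
  have h1 : P.V (P.τ ^ P.δ * (t * ratDeriv (P.τ ^ k * f))) 0 := P.value_deriv hf
  have h2 := P.value_mul (P.value_const (-(k : ℂ))) (P.value_mul P.value_deriv_τ hf)
  have h3 := P.value_add h1 h2
  unfold E
  convert h3 using 1
  · rw [h, zpow_add₀ P.τ_ne_zero, ratDeriv_mul, ratDeriv_zpow P.τ_ne_zero, const, map_neg,
      map_intCast]
    ring
  · ring

/-- The factor −kγ vanishes for k = 0, so the order drops to δ − 1 ≤ 0. -/
theorem E.deriv_regular (hf : P.E 0 f z) : ∃ w, P.E 0 (t * ratDeriv f) w := by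
  have h : P.E P.δ (t * ratDeriv f) (-((0 : ℤ) : ℂ) * P.γ * z) := hf.deriv
  rw [Int.cast_zero, neg_zero, zero_mul, zero_mul] at h
  obtain ⟨w, hw⟩ := h.pred rfl
  have := P.δ_le_one
  exact hw.le

theorem E.order_le (hf : P.E k f z) (hz : z ≠ 0) (hf' : P.E l f w) : k ≤ l := by
  by_contra! h
  exact hz (hf.unique (hf'.lift h))

theorem E_or_pair (P : Place) (k : ℤ) (f g : RatFunc ℂ) :
    (∃ z w, P.E k f z ∧ P.E k g w) ∨
      ∃ (l : ℤ) (z w : ℂ), k < l ∧ P.E l f z ∧ P.E l g w ∧ (z ≠ 0 ∨ w ≠ 0) := by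
  rcases P.E_or k f with ⟨z, hf⟩ | ⟨l, z, hl, hz, hf⟩ <;>
    rcases P.E_or k g with ⟨w, hg⟩ | ⟨m, w, hm, hw, hg⟩
  · exact Or.inl ⟨z, w, hf, hg⟩
  · exact Or.inr ⟨m, 0, w, hm, hf.lift, hg, Or.inr hw⟩
  · exact Or.inr ⟨l, z, 0, hl, hf, hg.lift, Or.inl hz⟩
  · rcases le_total l m with h | h
    · obtain ⟨z', hf'⟩ := hf.le h
      exact Or.inr ⟨m, z', w, hm, hf', hg, Or.inr hw⟩
    · obtain ⟨w', hg'⟩ := hg.le h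
      exact Or.inr ⟨l, z, w', hl, hf, hg', Or.inl hz⟩

end Place


/-! ### Pole orders of solutions -/

/-- The Sasano system, written with `H = q₁ p₁ + q₂ p₂`. -/
structure HSystem (q₁ p₁ q₂ p₂ H : RatFunc ℂ) (a b₁ b₂ : ℂ) : Prop where
  eq_H : H = q₁ * p₁ + q₂ * p₂
  eq_q₁ : t * ratDeriv q₁ = 2 * (q₁ * H) - q₁ * q₁ + const a * q₁ - t + 4 * (t * p₂)
  eq_p₁ : t * ratDeriv p₁ = const b₁ - const a * p₁ - p₁ * (2 * (H - q₁))
  eq_q₂ : t * ratDeriv q₂ = 2 * (q₂ * H) - q₂ * q₂ + const a * q₂ - t + 4 * (t * p₁)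
  eq_p₂ : t * ratDeriv p₂ = const b₂ - const a * p₂ - p₂ * (2 * (H - q₂))

namespace HSystem

open Place

variable {P : Place} {q₁ p₁ q₂ p₂ H : RatFunc ℂ} {a b₁ b₂ : ℂ} {k m n : ℤ} {A B C D x y h : ℂ}

theorem symm (S : HSystem q₁ p₁ q₂ p₂ H a b₁ b₂) : HSystem q₂ p₂ q₁ p₁ H a b₂ b₁ :=
  ⟨by rw [S.eq_H, add_comm], S.eq_q₂, S.eq_p₂, S.eq_q₁, S.eq_p₁⟩

/-- Dividing the p₁-equation by p₁ expresses 2(H − q₁) through the logarithmic derivative of p₁, of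
order at most δ, and through b₁/p₁ − a, which is regular at a pole of p₁. -/
theorem exists_E_sub (S : HSystem q₁ p₁ q₂ p₂ H a b₁ b₂) (hp : P.E n p₁ C) (hC : C ≠ 0)
    (hn : 0 < n) : ∃ w, P.E P.δ (H - q₁) w := by
  have hδ := P.δ_nonneg
  obtain ⟨w, hw⟩ := (hp.const_mul a).le (l := n + P.δ)
  have h1 := (((E_const b₁).lift (l := n + P.δ)).sub hw).sub hp.deriv
  have h2 := (h1.congr (g := p₁ * (2 * (H - q₁))) (by linear_combination -S.eq_p₁))
  have h3 := (hp.cancel hC h2 (l := P.δ)).const_mul (1 / 2)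
  exact ⟨_, h3.congr (by rw [const, map_div₀, map_one, map_ofNat]; ring)⟩

/-- `p₁` and `q₁` do not both have poles, if that of `q₁` has order more than `δ`. -/
theorem not_pole_p₁_q₁ (S : HSystem q₁ p₁ q₂ p₂ H a b₁ b₂) (hp : P.E n p₁ C) (hC : C ≠ 0)
    (hn : 0 < n) (hq : P.E m q₁ A) (hA : A ≠ 0) (hm : P.δ < m) : False := by
  have hδ := P.δ_nonneg
  have hδ1 := P.δ_le_one
  have he := P.e_le_one
  obtain ⟨w, hHq⟩ := S.exists_E_sub hp hC hn
  have hH : P.E m H A := by simpa using hq.add (hHq.lift hm)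
  -- If p₂ is regular, q₂p₂ must cancel the leading term of q₁p₁, since H only has order m. This
  -- makes the pole of q₂ so large that q₂² dominates its own equation.
  rcases P.E_or 0 p₂ with ⟨d, hp2⟩ | ⟨l, D, hl, hD, hp2⟩
  · have h1 := ((hH.lift (l := m + n)).sub (hq.mul hp)).congr (g := q₂ * p₂)
      (by rw [S.eq_H]; ring)
    have h1z : (0 : ℂ) - A * C ≠ 0 := by simp [hA, hC]
    obtain ⟨j, D, hD, hp2'⟩ := exists_E (P := P) (right_ne_zero_of_mul (h1.ne_zero h1z))
    have hj := hp2'.order_le hD hp2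
    have hq2 := hp2'.cancel hD (h1.congr (mul_comm _ _)) (l := m + n - j)
    have h2 := (((((hq2.mul hH rfl).two_mul.lift (l := 2 * (m + n - j))).add
      ((hq2.const_mul a).lift)).sub E_t.lift).add (E_t.mul hp rfl).four_mul.lift).sub
      (hq2.deriv rfl).lift
    have h3 := h2.congr (g := q₂ * q₂) (by linear_combination -S.eq_q₂)
    have h4 := h3.unique (hq2.mul hq2)
    simp [hA, hC, hD] at h4
  -- If p₂ also has a pole, q₁, q₂ and H share the leading coefficient A, and the q-equations give
  -- both p's the leading coefficient −A²/(4T) in order 2m − e. Then q₁p₁ + q₂p₂ has order 3m − e >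
  -- m, too large for H.
  · obtain ⟨w', hHq2⟩ := S.symm.exists_E_sub hp2 hD hl
    have hq2 : P.E m q₂ A := by simpa using hH.sub (hHq2.lift hm)
    have key : ∀ {q p : RatFunc ℂ} {w : ℂ}, P.E m q A → P.E P.δ (H - q) w →
        t * ratDeriv q = 2 * (q * H) - q * q + const a * q - t + 4 * (t * p) →
        P.E (2 * m - P.e) p (-(A * A) / (4 * P.T)) := by
      intro q p w hq hHq hS
      have h1 := (((((hq.deriv rfl).lift (l := 2 * m)).sub
        ((hq.mul hHq rfl).two_mul.lift)).sub (hq.mul hq)).sub ((hq.const_mul a).lift)).add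
        E_t.lift
      have h2 := h1.congr (g := (4 * t) * p) (by linear_combination hS)
      have h3 := (E_t (P := P)).four_mul.cancel (mul_ne_zero (by norm_num : (4 : ℂ) ≠ 0) P.T_ne_zero) h2
        (l := 2 * m - P.e)
      simpa using h3
    have h1 := ((hq.mul (key hq2 hHq2 S.eq_q₂) rfl).add
      (hq2.mul (key hq hHq S.eq_q₁) rfl)).congr S.eq_H.symm
    have h2 := h1.unique (hH.lift)
    have hT := P.T_ne_zero
    field_simp at h2
    norm_num [hA] at h2

/-- The previous lemma reduces to regular p₂. The p₂-equation then makes p₂ vanish to order k, so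
q₁p₁ = H − q₂p₂ has order at most δ and q₁ order at most δ − n. The q₂-equation forces n ≥ 2k − e,
and in the q₁-equation t is left as the only term of order e. -/
theorem not_pole_p₁_q₂ (S : HSystem q₁ p₁ q₂ p₂ H a b₁ b₂) (hp : P.E n p₁ C) (hC : C ≠ 0)
    (hn : 0 < n) (hq1 : P.E P.δ q₁ A) (hq : P.E k q₂ B) (hB : B ≠ 0) (hk : P.δ < k) : False := by
  have hδ := P.δ_nonneg
  have hδ1 := P.δ_le_one
  have he := P.e_le_one
  rcases P.E_or 0 p₂ with ⟨d, hp2⟩ | ⟨l, D, hl, hD, hp2⟩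
  swap
  · exact S.symm.not_pole_p₁_q₁ hp2 hD hl hq hB hk
  obtain ⟨w, hHq⟩ := S.exists_E_sub hp hC hn
  have hH := (hq1.add hHq).congr (g := H) (by ring)
  have h1 : P.E k (2 * (H - q₂)) (2 * (0 - B)) := (hH.lift.sub hq).two_mul
  obtain ⟨w', hd⟩ := hp2.deriv_regular
  have h2 := (((E_const b₂).sub (hp2.const_mul a)).sub hd).congr (g := 2 * (H - q₂) * p₂)
    (by linear_combination -S.eq_p₂)
  have hp2' := h1.cancel (by simp [hB]) h2 (l := -k)
  obtain ⟨w'', h3⟩ := (hq.mul hp2' (n := 0)).le (l := P.δ)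
  have h4 := (hH.sub h3).congr (g := p₁ * q₁) (by rw [S.eq_H]; ring)
  have hq1' := hp.cancel hC h4 (l := P.δ - n)
  have h5 := (((((hq.mul hq).sub ((hq.mul hH rfl).two_mul.lift (l := 2 * k))).sub
    ((hq.const_mul a).lift)).add E_t.lift).add (hq.deriv rfl).lift).congr (g := (4 * t) * p₁)
    (by linear_combination S.eq_q₂)
  have h6 := (E_t (P := P)).four_mul.cancel (mul_ne_zero (by norm_num : (4 : ℂ) ≠ 0) P.T_ne_zero) h5
        (l := 2 * k - P.e)
  have h7 := h6.order_le (by simp [hB, P.T_ne_zero]) hp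
  have h8 := ((((((hq1'.mul hH rfl).two_mul.lift (l := P.e)).sub
    (hq1'.mul hq1' rfl).lift).add ((hq1'.const_mul a).lift)).add
    ((E_t (P := P)).mul hp2' rfl).four_mul.lift).sub (hq1'.deriv rfl).lift).congr (g := t)
    (by linear_combination -S.eq_q₁)
  have h9 := (E_t (P := P)).unique h8
  simp [P.T_ne_zero] at h9

/-- Let m > δ be the larger pole order of q₁, q₂ and h the coefficient of H in order m. Each pair of
coefficients (z, d) of (qᵢ, pᵢ) satisfies z(2h − z) = 0 and d(h − z) = 0, hence zd = 0. So h = AC +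
BD = 0, and then A = B = 0. -/
theorem exists_E_of_regular (S : HSystem q₁ p₁ q₂ p₂ H a b₁ b₂) (hp1 : P.E 0 p₁ C)
    (hp2 : P.E 0 p₂ D) : ∃ A B, P.E P.δ q₁ A ∧ P.E P.δ q₂ B := by
  have hδ := P.δ_nonneg
  have hδ1 := P.δ_le_one
  have he := P.e_le_one
  refine (P.E_or_pair P.δ q₁ q₂).resolve_right ?_
  rintro ⟨m, A, B, hm, hq1, hq2, hAB⟩
  have hH := ((hq1.mul hp1 (n := m)).add (hq2.mul hp2)).congr S.eq_H.symm
  have key : ∀ {q p p' : RatFunc ℂ} {z d h b : ℂ}, P.E m q z → P.E 0 p d → P.E 0 p' C ∨ P.E 0 p' D →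
      P.E m H h → t * ratDeriv q = 2 * (q * H) - q * q + const a * q - t + 4 * (t * p') →
      t * ratDeriv p = const b - const a * p - p * (2 * (H - q)) →
      z * (2 * h - z) = 0 ∧ d * (h - z) = 0 := by
    intro q p p' z d h b hq hp hp' hH hS hS'
    obtain ⟨c, hp'⟩ : ∃ c, P.E 0 p' c := hp'.elim (fun h => ⟨_, h⟩) (fun h => ⟨_, h⟩)
    constructor
    · have h1 := (((((hq.deriv rfl).lift (l := 2 * m)).sub ((hq.mul hH).two_mul)).sub
        ((hq.const_mul a).lift)).add E_t.lift).sub ((E_t (P := P)).mul hp' rfl).four_mul.lift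
      have h2 := (h1.congr (g := - (q * q)) (by linear_combination hS)).unique (hq.mul hq).neg
      linear_combination -h2
    · have h1 := (((E_const b).lift (l := m)).sub ((hp.const_mul a).lift)).sub
        (hp.deriv rfl).lift
      have h2 := (h1.congr (g := p * (2 * (H - q))) (by linear_combination -hS')).unique
        (hp.mul (hH.sub hq).two_mul)
      linear_combination -h2 / 2
  obtain ⟨h1, h2⟩ := key hq1 hp1 (Or.inr hp2) hH S.eq_q₁ S.eq_p₁
  obtain ⟨h3, h4⟩ := key hq2 hp2 (Or.inl hp1) hH S.eq_q₂ S.eq_p₂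
  have hprod : ∀ {z d h : ℂ}, z * (2 * h - z) = 0 → d * (h - z) = 0 → z * d = 0 := by
    intro z d h hz hd
    by_contra hzd
    have h1 := (mul_eq_zero.1 hz).resolve_left (left_ne_zero_of_mul hzd)
    have h2 := (mul_eq_zero.1 hd).resolve_left (right_ne_zero_of_mul hzd)
    exact left_ne_zero_of_mul hzd (by linear_combination h1 - 2 * h2)
  have h5 := hprod h1 h2
  have h6 := hprod h3 h4
  rw [h5, h6] at h1 h3
  simp at h1 h3
  tauto

/-- At every place `q₁`, `q₂` and `q₁ p₁ + q₂ p₂` have poles of order at most `δ`. -/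
theorem exists_E (S : HSystem q₁ p₁ q₂ p₂ H a b₁ b₂) (P : Place) :
    ∃ A B h, P.E P.δ q₁ A ∧ P.E P.δ q₂ B ∧ P.E P.δ H h := by
  have hδ := P.δ_nonneg
  have key : ∀ {q₁ p₁ q₂ p₂ : RatFunc ℂ} {b₁ b₂ : ℂ}, HSystem q₁ p₁ q₂ p₂ H a b₁ b₂ →
      ∀ {n : ℤ} {C : ℂ}, P.E n p₁ C → C ≠ 0 → 0 < n →
      ∃ A B h, P.E P.δ q₁ A ∧ P.E P.δ q₂ B ∧ P.E P.δ H h := by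
    intro q₁ p₁ q₂ p₂ b₁ b₂ S n C hp hC hn
    rcases P.E_or P.δ q₁ with ⟨A, hq1⟩ | ⟨m, A, hm, hA, hq1⟩
    swap
    · exact (S.not_pole_p₁_q₁ hp hC hn hq1 hA hm).elim
    rcases P.E_or P.δ q₂ with ⟨B, hq2⟩ | ⟨m, B, hm, hB, hq2⟩
    swap
    · exact (S.not_pole_p₁_q₂ hp hC hn hq1 hq2 hB hm).elim
    obtain ⟨w, hHq⟩ := S.exists_E_sub hp hC hn
    exact ⟨A, B, _, hq1, hq2, (hq1.add hHq).congr (by ring)⟩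
  rcases P.E_or 0 p₁ with ⟨C, hp1⟩ | ⟨n, C, hn, hC, hp1⟩
  swap
  · exact key S hp1 hC hn
  rcases P.E_or 0 p₂ with ⟨D, hp2⟩ | ⟨n, D, hn, hD, hp2⟩
  swap
  · obtain ⟨A, B, h, h1, h2, h3⟩ := key S.symm hp2 hD hn
    exact ⟨B, A, h, h2, h1, h3⟩
  obtain ⟨A, B, hq1, hq2⟩ := S.exists_E_of_regular hp1 hp2
  exact ⟨A, B, _, hq1, hq2,
    ((hq1.mul hp1 (n := P.δ)).add (hq2.mul hp2)).congr S.eq_H.symm⟩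

end HSystem

/-! ### The places of `ℂ(t)` -/

theorem mul_eq_mul_of_div_eq_div {N D N' D' : ℂ[X]} (hD : D ≠ 0) (hD' : D' ≠ 0)
    (h : algebraMap ℂ[X] (RatFunc ℂ) N / algebraMap ℂ[X] (RatFunc ℂ) D =
      algebraMap ℂ[X] (RatFunc ℂ) N' / algebraMap ℂ[X] (RatFunc ℂ) D') : N * D' = N' * D := by
  rw [div_eq_div_iff (RatFunc.algebraMap_ne_zero hD) (RatFunc.algebraMap_ne_zero hD'),
    ← map_mul, ← map_mul] at h
  exact RatFunc.algebraMap_injective ℂ h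

/-- The rational function `f` is regular at `c` with value `z`. -/
def ValueAt (c : ℂ) (f : RatFunc ℂ) (z : ℂ) : Prop :=
  ∃ N D : ℂ[X], D.eval c ≠ 0 ∧
    f = algebraMap ℂ[X] (RatFunc ℂ) N / algebraMap ℂ[X] (RatFunc ℂ) D ∧
    N.eval c = z * D.eval c

namespace ValueAt

variable {c z w : ℂ} {f g : RatFunc ℂ}

theorem ne_zero_of_eval {D : ℂ[X]} (hD : D.eval c ≠ 0) : D ≠ 0 := by
  rintro rfl
  simp at hD

theorem of_algebraMap (N : ℂ[X]) : ValueAt c (algebraMap ℂ[X] (RatFunc ℂ) N) (N.eval c) :=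
  ⟨N, 1, by simp, by simp, by simp⟩

theorem of_const (a : ℂ) : ValueAt c (const a) a := by
  simpa [RatFunc.algebraMap_C] using of_algebraMap (c := c) (Polynomial.C a)

theorem of_t : ValueAt c t c := by
  simpa [RatFunc.algebraMap_X] using of_algebraMap (c := c) Polynomial.X

theorem of_one : ValueAt c 1 1 := by
  simpa using of_const (c := c) 1

theorem add (hf : ValueAt c f z) (hg : ValueAt c g w) : ValueAt c (f + g) (z + w) := by
  obtain ⟨N, D, hD, rfl, h⟩ := hf
  obtain ⟨N', D', hD', rfl, h'⟩ := hg
  refine ⟨N * D' + D * N', D * D', by simp [hD, hD'], ?_, ?_⟩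
  · rw [div_add_div _ _ (RatFunc.algebraMap_ne_zero (ne_zero_of_eval hD))
      (RatFunc.algebraMap_ne_zero (ne_zero_of_eval hD'))]
    simp only [map_add, map_mul]
  · simp only [eval_add, eval_mul, h, h']
    ring

theorem mul (hf : ValueAt c f z) (hg : ValueAt c g w) : ValueAt c (f * g) (z * w) := by
  obtain ⟨N, D, hD, rfl, h⟩ := hf
  obtain ⟨N', D', hD', rfl, h'⟩ := hg
  refine ⟨N * N', D * D', by simp [hD, hD'], ?_, ?_⟩
  · rw [div_mul_div_comm]
    simp only [map_mul]
  · simp only [eval_mul, h, h']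
    ring

theorem unique (hf : ValueAt c f z) (hf' : ValueAt c f w) : z = w := by
  obtain ⟨N, D, hD, rfl, h⟩ := hf
  obtain ⟨N', D', hD', he, h'⟩ := hf'
  have key := congrArg (Polynomial.eval c)
    (mul_eq_mul_of_div_eq_div (ne_zero_of_eval hD) (ne_zero_of_eval hD') he)
  simp only [eval_mul, h, h'] at key
  have : (z - w) * (D.eval c * D'.eval c) = 0 := by linear_combination key
  simpa [hD, hD', sub_eq_zero] using this

theorem div (hf : ValueAt c f 0) : ∃ w, ValueAt c (f / (t - const c)) w := by
  obtain ⟨N, D, hD, rfl, h⟩ := hf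
  rw [zero_mul] at h
  obtain ⟨M, rfl⟩ := dvd_iff_isRoot.2 h
  refine ⟨M.eval c / D.eval c, M, D, hD, ?_, by field_simp⟩
  have h0 := RatFunc.algebraMap_ne_zero (X_sub_C_ne_zero c)
  rw [map_mul, show t - const c = algebraMap ℂ[X] (RatFunc ℂ) (X - Polynomial.C c) by
    rw [map_sub, RatFunc.algebraMap_X, RatFunc.algebraMap_C]]
  field_simp

theorem sub_const_ne_zero (c : ℂ) : t - const c ≠ 0 := by
  have h0 := RatFunc.algebraMap_ne_zero (X_sub_C_ne_zero c)
  rwa [map_sub, RatFunc.algebraMap_X, RatFunc.algebraMap_C] at h0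

theorem of_sub : ValueAt c (t - const c) 0 := by
  have h := of_algebraMap (c := c) (X - Polynomial.C c)
  rwa [map_sub, RatFunc.algebraMap_X, RatFunc.algebraMap_C, eval_sub, eval_X, eval_C,
    sub_self] at h

theorem exists_order (c : ℂ) (hf : f ≠ 0) :
    ∃ (k : ℤ) (z : ℂ), z ≠ 0 ∧ ValueAt c ((t - const c) ^ k * f) z := by
  obtain ⟨N, D, hD, rfl⟩ := exists_eq_div f
  have hN : N ≠ 0 := by rintro rfl; simp at hf
  obtain ⟨N', hN', hNc⟩ := exists_eq_pow_rootMultiplicity_mul_and_not_dvd N hN c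
  obtain ⟨D', hD', hDc⟩ := exists_eq_pow_rootMultiplicity_mul_and_not_dvd D hD c
  rw [dvd_iff_isRoot, IsRoot.def] at hNc hDc
  refine ⟨(D.rootMultiplicity c : ℤ) - N.rootMultiplicity c, N'.eval c / D'.eval c,
    div_ne_zero hNc hDc, N', D', hDc, ?_, by field_simp⟩
  have h0 := sub_const_ne_zero c
  have h1 := RatFunc.algebraMap_ne_zero (ne_zero_of_eval hDc)
  rw [hN', hD', map_mul, map_mul, map_pow, map_pow, map_sub, RatFunc.algebraMap_X,
    RatFunc.algebraMap_C, ← hN', ← hD', zpow_sub₀ h0, zpow_natCast, zpow_natCast]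
  change t - const c ≠ 0 at h0
  change (t - const c) ^ _ / (t - const c) ^ _ *
    ((t - const c) ^ _ * _ / ((t - const c) ^ _ * _)) = _
  field_simp

theorem deriv (hf : ValueAt c f z) : ∃ w, ValueAt c (ratDeriv f) w := by
  obtain ⟨N, D, hD, rfl, h⟩ := hf
  exact ⟨_, _, _, by simpa using hD, ratDeriv_div _ _ (ne_zero_of_eval hD),
    (div_mul_cancel₀ _ (by simpa using hD)).symm⟩

end ValueAt

theorem ratDeriv_t_sub_const (c : ℂ) : ratDeriv (t - const c) = 1 := by
  rw [ratDeriv_sub, ratDeriv_t, ratDeriv_const, sub_zero]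

/-- The place `t = c` for `c ≠ 0`. -/
noncomputable def finitePlace (c : ℂ) (hc : c ≠ 0) : Place where
  V := ValueAt c
  τ := t - const c
  δ := 1
  e := 0
  γ := c
  T := c
  τ_ne_zero := ValueAt.sub_const_ne_zero c
  value_const := ValueAt.of_const
  value_add := ValueAt.add
  value_mul := ValueAt.mul
  value_unique := ValueAt.unique
  value_τ := ValueAt.of_sub
  value_div := ValueAt.div
  exists_order := ValueAt.exists_order c
  value_deriv h := by
    obtain ⟨w, hw⟩ := h.deriv
    simpa using ValueAt.of_sub.mul (ValueAt.of_t.mul hw)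
  value_deriv_τ := by
    rw [ratDeriv_t_sub_const, zpow_one, mul_one, mul_div_cancel₀ _ (ValueAt.sub_const_ne_zero c)]
    exact ValueAt.of_t
  value_t := by simpa using ValueAt.of_t
  T_ne_zero := hc
  δ_nonneg := by norm_num
  δ_le_one := by norm_num
  e_le_one := by norm_num

/-- The place `t = 0`. -/
noncomputable def zeroPlace : Place where
  V := ValueAt 0
  -- The parameter is not simplified to `t`, so that the lemmas for `ValueAt c` apply verbatim at c
  -- = 0.
  τ := t - const 0
  δ := 0
  e := -1
  γ := 1
  T := 1
  τ_ne_zero := ValueAt.sub_const_ne_zero 0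
  value_const := ValueAt.of_const
  value_add := ValueAt.add
  value_mul := ValueAt.mul
  value_unique := ValueAt.unique
  value_τ := ValueAt.of_sub
  value_div := ValueAt.div
  exists_order := ValueAt.exists_order 0
  value_deriv h := by
    obtain ⟨w, hw⟩ := h.deriv
    simpa using ValueAt.of_t.mul hw
  value_deriv_τ := by
    have h : t ≠ 0 := RatFunc.X_ne_zero
    rw [ratDeriv_t_sub_const, const, map_zero, sub_zero, zpow_zero, mul_one, one_mul, div_self h]
    exact ValueAt.of_one
  value_t := by
    have h : t ≠ 0 := RatFunc.X_ne_zero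
    rw [const, map_zero, sub_zero, zpow_neg_one, inv_mul_cancel₀ h]
    exact ValueAt.of_one
  T_ne_zero := one_ne_zero
  δ_nonneg := by norm_num
  δ_le_one := by norm_num
  e_le_one := by norm_num

/-- The rational function `f` is regular at infinity with value `z`. -/
def ValueAtInfinity (f : RatFunc ℂ) (z : ℂ) : Prop :=
  ∃ (N D : ℂ[X]) (n : ℕ), D.coeff n ≠ 0 ∧ N.natDegree ≤ n ∧ D.natDegree ≤ n ∧
    f = algebraMap ℂ[X] (RatFunc ℂ) N / algebraMap ℂ[X] (RatFunc ℂ) D ∧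
    N.coeff n = z * D.coeff n

namespace ValueAtInfinity

variable {z w : ℂ} {f g : RatFunc ℂ}

theorem ne_zero_of_coeff {D : ℂ[X]} {n : ℕ} (hD : D.coeff n ≠ 0) : D ≠ 0 := by
  rintro rfl
  simp at hD

theorem of_const (a : ℂ) : ValueAtInfinity (const a) a :=
  ⟨Polynomial.C a, 1, 0, by simp, by simp, by simp, by simp [RatFunc.algebraMap_C], by simp⟩

theorem add (hf : ValueAtInfinity f z) (hg : ValueAtInfinity g w) :
    ValueAtInfinity (f + g) (z + w) := by
  obtain ⟨N, D, n, hD, h1, h2, rfl, h⟩ := hf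
  obtain ⟨N', D', n', hD', h1', h2', rfl, h'⟩ := hg
  refine ⟨N * D' + D * N', D * D', n + n', ?_, ?_, ?_, ?_, ?_⟩
  · rw [coeff_mul_add_eq_of_natDegree_le h2 h2']
    exact mul_ne_zero hD hD'
  · exact natDegree_add_le_of_degree_le (natDegree_mul_le_of_le h1 h2')
      (natDegree_mul_le_of_le h2 h1')
  · exact natDegree_mul_le_of_le h2 h2'
  · rw [div_add_div _ _ (RatFunc.algebraMap_ne_zero (ne_zero_of_coeff hD))
      (RatFunc.algebraMap_ne_zero (ne_zero_of_coeff hD'))]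
    simp only [map_add, map_mul]
  · rw [coeff_add, coeff_mul_add_eq_of_natDegree_le h1 h2', coeff_mul_add_eq_of_natDegree_le h2 h1',
      coeff_mul_add_eq_of_natDegree_le h2 h2', h, h']
    ring

theorem mul (hf : ValueAtInfinity f z) (hg : ValueAtInfinity g w) :
    ValueAtInfinity (f * g) (z * w) := by
  obtain ⟨N, D, n, hD, h1, h2, rfl, h⟩ := hf
  obtain ⟨N', D', n', hD', h1', h2', rfl, h'⟩ := hg
  refine ⟨N * N', D * D', n + n', ?_, natDegree_mul_le_of_le h1 h1',
    natDegree_mul_le_of_le h2 h2', ?_, ?_⟩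
  · rw [coeff_mul_add_eq_of_natDegree_le h2 h2']
    exact mul_ne_zero hD hD'
  · rw [div_mul_div_comm]
    simp only [map_mul]
  · rw [coeff_mul_add_eq_of_natDegree_le h1 h1', coeff_mul_add_eq_of_natDegree_le h2 h2', h, h']
    ring

theorem unique (hf : ValueAtInfinity f z) (hf' : ValueAtInfinity f w) : z = w := by
  obtain ⟨N, D, n, hD, h1, h2, rfl, h⟩ := hf
  obtain ⟨N', D', n', hD', h1', h2', he, h'⟩ := hf'
  have key := congrArg (fun p => Polynomial.coeff p (n + n'))
    (mul_eq_mul_of_div_eq_div (ne_zero_of_coeff hD) (ne_zero_of_coeff hD') he)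
  rw [coeff_mul_add_eq_of_natDegree_le h1 h2', add_comm n, coeff_mul_add_eq_of_natDegree_le h1' h2, h, h'] at key
  have : (z - w) * (D.coeff n * D'.coeff n') = 0 := by linear_combination key
  simpa [hD, hD', sub_eq_zero] using this

theorem of_inv_t : ValueAtInfinity t⁻¹ 0 :=
  ⟨1, X, 1, by simp, by simp, by simp, by simp [RatFunc.algebraMap_X], by simp [coeff_one]⟩

theorem div (hf : ValueAtInfinity f 0) : ∃ w, ValueAtInfinity (f / t⁻¹) w := by
  obtain ⟨N, D, n, hD, h1, h2, rfl, h⟩ := hf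
  rw [zero_mul] at h
  refine ⟨(N * X).coeff n / D.coeff n, N * X, D, n, hD, ?_, h2, ?_, by field_simp⟩
  · rw [natDegree_le_iff_coeff_eq_zero] at h1 ⊢
    rintro (_ | m) hm
    · omega
    · rw [coeff_mul_X]
      rcases (Nat.lt_succ_iff.1 hm).eq_or_lt with rfl | hm
      · exact h
      · exact h1 m hm
  · rw [map_mul, RatFunc.algebraMap_X, div_inv_eq_mul]
    ring

theorem exists_order (hf : f ≠ 0) :
    ∃ (k : ℤ) (z : ℂ), z ≠ 0 ∧ ValueAtInfinity (t⁻¹ ^ k * f) z := by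
  obtain ⟨N, D, hD, rfl⟩ := exists_eq_div f
  have hN : N ≠ 0 := by rintro rfl; simp at hf
  have hN' : N.coeff N.natDegree ≠ 0 := leadingCoeff_ne_zero.2 hN
  have hD' : D.coeff D.natDegree ≠ 0 := leadingCoeff_ne_zero.2 hD
  refine ⟨(N.natDegree : ℤ) - D.natDegree, N.coeff N.natDegree / D.coeff D.natDegree,
    div_ne_zero hN' hD', N * X ^ D.natDegree, D * X ^ N.natDegree, N.natDegree + D.natDegree,
    ?_, ?_, ?_, ?_, ?_⟩
  · rwa [add_comm, coeff_mul_X_pow]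
  · exact natDegree_mul_le_of_le le_rfl (natDegree_X_pow_le _)
  · rw [add_comm]
    exact natDegree_mul_le_of_le le_rfl (natDegree_X_pow_le _)
  · have h0 : t ≠ 0 := RatFunc.X_ne_zero
    have h1 := RatFunc.algebraMap_ne_zero hD
    simp only [map_mul, map_pow, RatFunc.algebraMap_X]
    rw [zpow_sub₀ (inv_ne_zero h0), zpow_natCast, zpow_natCast, inv_pow, inv_pow]
    change (t ^ _)⁻¹ / (t ^ _)⁻¹ * (_ / _) = _ * t ^ _ / (_ * t ^ _)
    field_simp
  · rw [coeff_mul_X_pow, add_comm, coeff_mul_X_pow]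
    field_simp

theorem natDegree_X_mul_derivative_le {N : ℂ[X]} {n : ℕ} (h : N.natDegree ≤ n) :
    (X * derivative N).natDegree ≤ n := by
  rw [natDegree_le_iff_coeff_eq_zero] at h ⊢
  rintro (_ | m) hm
  · omega
  · rw [coeff_X_mul, coeff_derivative, h _ hm, zero_mul]

theorem coeff_X_mul_derivative (N : ℂ[X]) (n : ℕ) :
    (X * derivative N).coeff n = n * N.coeff n := by
  cases n with
  | zero => simp
  | succ n =>
    rw [coeff_X_mul, coeff_derivative]
    push_cast
    ring

/-- The operator X d/dX multiplies the n-th coefficient by n, so the top coefficients of XN'D and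
NXD' cancel. -/
theorem deriv (hf : ValueAtInfinity f z) : ValueAtInfinity (t * ratDeriv f) 0 := by
  obtain ⟨N, D, n, hD, h1, h2, rfl, h⟩ := hf
  have h1' := natDegree_X_mul_derivative_le h1
  have h2' := natDegree_X_mul_derivative_le h2
  refine ⟨X * derivative N * D - N * (X * derivative D), D * D, n + n, ?_, ?_,
    natDegree_mul_le_of_le h2 h2, ?_, ?_⟩
  · rw [coeff_mul_add_eq_of_natDegree_le h2 h2]
    exact mul_ne_zero hD hD
  · exact natDegree_sub_le_of_le (natDegree_mul_le_of_le h1' h2) (natDegree_mul_le_of_le h1 h2')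
      |>.trans (max_self _).le
  · rw [ratDeriv_div _ _ (ne_zero_of_coeff hD)]
    simp only [map_sub, map_mul, map_pow, RatFunc.algebraMap_X]
    ring
  · rw [coeff_sub, coeff_mul_add_eq_of_natDegree_le h1' h2, coeff_mul_add_eq_of_natDegree_le h1 h2',
      coeff_X_mul_derivative, coeff_X_mul_derivative]
    ring

end ValueAtInfinity

/-- The place `t = ∞`. -/
noncomputable def infinitePlace : Place where
  V := ValueAtInfinity
  τ := t⁻¹
  δ := 0
  e := 1
  γ := -1
  T := 1
  τ_ne_zero := inv_ne_zero RatFunc.X_ne_zero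
  value_const := ValueAtInfinity.of_const
  value_add := ValueAtInfinity.add
  value_mul := ValueAtInfinity.mul
  value_unique := ValueAtInfinity.unique
  value_τ := ValueAtInfinity.of_inv_t
  value_div := ValueAtInfinity.div
  exists_order := ValueAtInfinity.exists_order
  value_deriv h := by simpa using h.deriv
  value_deriv_τ := by
    have h : t ≠ 0 := RatFunc.X_ne_zero
    have h1 : t ^ (0 : ℤ) * (t * ratDeriv t⁻¹ / t⁻¹) = const (-1) := by
      rw [← one_div, ratDeriv_div' _ _ h, ratDeriv_one, ratDeriv_t, const, map_neg, map_one]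
      field_simp
      ring
    rw [zpow_zero] at h1 ⊢
    rw [h1]
    exact ValueAtInfinity.of_const _
  value_t := by
    have h : t ≠ 0 := RatFunc.X_ne_zero
    rw [zpow_one, inv_mul_cancel₀ h]
    simpa using ValueAtInfinity.of_const 1
  T_ne_zero := one_ne_zero
  δ_nonneg := by norm_num
  δ_le_one := by norm_num
  e_le_one := by norm_num


namespace HSystem

open Place

variable {P : Place} {q₁ p₁ q₂ p₂ H : RatFunc ℂ} {a b₁ b₂ : ℂ} {A B C D x y h : ℂ}

/-! ### Leading coefficients at `c ≠ 0` -/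

/-- When only p₁ has a double pole, the leading orders leave B free, so further coefficients are
compared. A nonzero constant term of q₁ would force B = T/2 and C = T/4, against `hC`. After that,
the constant term y of p₂ satisfies y(T − B) = 0, and y = 0 gives C = T, so that `hC` becomes (B −
4T)(B + T) = 0. -/
theorem leading_finite_of_pole (S : HSystem q₁ p₁ q₂ p₂ H a b₁ b₂) (hδ : P.δ = 1) (he : P.e = 0)
    (hγ : P.γ = P.T) (hq1 : P.E 1 q₁ 0) (hq2 : P.E 1 q₂ B) (hH : P.E 1 H P.T)
    (hp1 : P.E 2 p₁ C) (hp2 : P.E 2 p₂ 0) (hC : 4 * P.T * C = B * B - 3 * P.T * B) :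
    B = P.T ∨ B = 4 * P.T ∨ B = -P.T := by
  have hT := P.T_ne_zero
  obtain ⟨x, hq1⟩ := hq1.pred (l := 0) rfl
  obtain ⟨d, hp2⟩ := hp2.pred (l := 1) rfl
  have ht : P.E 0 t P.T := he ▸ E_t
  have e1 := ((((((hq1.mul hH (n := 1)).two_mul).sub (hq1.mul hq1 rfl).lift).add
    (hq1.const_mul a).lift).sub ht.lift).add (ht.mul hp2).four_mul).congr S.eq_q₁.symm
    |>.unique (hq1.deriv)
  have e2 := ((hq1.mul hp1).add (hq2.mul hp2)).congr S.eq_H.symm |>.unique (hH.lift (l := 2))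
  have e3 := ((((E_const b₂).lift).sub ((hp2.const_mul a).lift)).sub
    (hp2.mul (hH.sub hq2).two_mul)).congr S.eq_p₂.symm |>.unique (hp2.deriv (n := 2))
  rw [hγ] at e1 e3
  push_cast at e1 e3
  have hd : d = -x / 2 := by
    apply mul_left_cancel₀ hT
    linear_combination e1 / 4
  obtain rfl : x = 0 := by
    by_contra hx
    have h1 : B = P.T / 2 := by
      apply mul_left_cancel₀ hx
      rw [hd] at e3
      linear_combination -e3
    have h2 : C = P.T / 4 := by
      apply mul_left_cancel₀ hx
      rw [hd, h1] at e2
      linear_combination e2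
    rw [h1, h2] at hC
    apply hT
    have h3 : P.T * P.T = 0 := by linear_combination (4 / 9) * hC
    simpa using h3
  rw [neg_zero, zero_div] at hd
  rw [hd] at hp2
  obtain ⟨y, hp2⟩ := hp2.pred (l := 0) rfl
  obtain ⟨x, hq1⟩ := hq1.pred (l := -1) rfl
  have e1 := ((((((hq1.mul hH (n := 0)).two_mul).sub (hq1.mul hq1 rfl).lift).add
    (hq1.const_mul a).lift).sub ht).add (ht.mul hp2).four_mul).congr S.eq_q₁.symm
    |>.unique (hq1.deriv)
  have e2 := ((hq1.mul hp1 (n := 1)).add (hq2.mul hp2)).congr S.eq_H.symm |>.unique hH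
  have e3 := ((((E_const b₂).lift).sub ((hp2.const_mul a).lift)).sub
    (hp2.mul (hH.sub hq2).two_mul (n := 1))).congr S.eq_p₂.symm |>.unique hp2.deriv
  rw [hγ] at e1 e3
  push_cast at e1 e3
  rcases mul_eq_zero.1 (show y * (P.T - B) = 0 by linear_combination -e3 / 2) with rfl | hB
  · right
    obtain rfl : x = 1 := by
      apply mul_left_cancel₀ hT
      linear_combination e1
    have h1 : (B - 4 * P.T) * (B + P.T) = 0 := by
      linear_combination -hC + 4 * P.T * e2
    rcases mul_eq_zero.1 h1 with h1 | h1
    · exact Or.inl (by linear_combination h1)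
    · exact Or.inr (by linear_combination h1)
  · exact Or.inl (by linear_combination -hB)

/-- The residues of `q₁`, `q₂` and `2 H` with respect to `dt / t` are integers. -/
theorem leading_finite (S : HSystem q₁ p₁ q₂ p₂ H a b₁ b₂) (hδ : P.δ = 1) (he : P.e = 0)
    (hγ : P.γ = P.T) : ∃ i j k : ℤ, P.E 1 q₁ (i * P.T) ∧ P.E 1 q₂ (j * P.T) ∧
      P.E 1 (2 * H) (k * P.T) := by
  have hT := P.T_ne_zero
  have ht : P.E 0 t P.T := he ▸ E_t
  obtain ⟨A, B, h, hq1, hq2, hH⟩ := S.exists_E P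
  rw [hδ] at hq1 hq2 hH
  suffices hs : ∃ i j k : ℤ, A = i * P.T ∧ B = j * P.T ∧ 2 * h = k * P.T by
    obtain ⟨i, j, k, rfl, rfl, hk⟩ := hs
    exact ⟨i, j, k, hq1, hq2, hk ▸ hH.two_mul⟩
  have hp : ∀ {q p : RatFunc ℂ} {z : ℂ}, P.E 1 q z →
      t * ratDeriv q = 2 * (q * H) - q * q + const a * q - t + 4 * (t * p) →
      ∃ d, P.E 2 p d ∧ 4 * P.T * d = z * z - 2 * z * h - P.T * z := by
    intro q p z hq hS
    have h1 := ((((hq.deriv (n := 2)).sub (hq.mul hH).two_mul).add (hq.mul hq)).sub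
      (hq.const_mul a).lift).add ht.lift
    have h2 := h1.congr (g := 4 * t * p) (by linear_combination hS)
    have h3 := ht.four_mul.cancel (mul_ne_zero (by norm_num) hT) h2 (l := 2)
    refine ⟨_, h3, ?_⟩
    rw [hγ, mul_div_cancel₀ _ (mul_ne_zero (by norm_num) hT)]
    push_cast
    ring
  have hpS : ∀ {n : ℤ} {q p : RatFunc ℂ} {b z d : ℂ}, 0 ≤ n → P.E 1 q z → P.E n p d →
      t * ratDeriv p = const b - const a * p - p * (2 * (H - q)) →
      d * (2 * (h - z) - n * P.T) = 0 := by
    intro n q p b z d hn hq hp hS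
    have h1 := ((((E_const b).lift).sub (hp.const_mul a).lift).sub
      (hp.mul (hH.sub hq).two_mul rfl)).congr hS.symm |>.unique (hp.deriv)
    rw [hγ] at h1
    linear_combination -h1
  obtain ⟨D, hp2, hD⟩ := hp hq1 S.eq_q₁
  obtain ⟨C, hp1, hC⟩ := hp hq2 S.eq_q₂
  have hHp := ((hq1.mul hp1).add (hq2.mul hp2)).congr S.eq_H.symm |>.unique (hH.lift (l := 3))
  have hCS := hpS zero_le_two hq1 hp1 S.eq_p₁
  have hDS := hpS zero_le_two hq2 hp2 S.eq_p₂
  push_cast at hCS hDS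
  -- The cases follow the pole orders of p₁ and p₂, from 2 down to 0. A nonzero coefficient of pᵢ in
  -- order n forces 2(h − z) = nT, where z is that of qᵢ.
  by_cases hC0 : C = 0
  swap
  · have hhA : h = A + P.T := by
      linear_combination ((mul_eq_zero.1 hCS).resolve_left hC0) / 2
    by_cases hD0 : D = 0
    swap
    · exfalso
      have hhB : h = B + P.T := by
        linear_combination ((mul_eq_zero.1 hDS).resolve_left hD0) / 2
      obtain rfl : A = B := by linear_combination hhB - hhA
      obtain rfl : C = D := by
        apply mul_left_cancel₀ hT
        linear_combination (hC - hD) / 4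
      have hA : A = 0 := by
        apply mul_left_cancel₀ hC0
        linear_combination hHp / 2
      rw [hA] at hC
      have : P.T * C = 0 := by linear_combination hC / 4
      simp_all
    · subst hD0
      obtain rfl : A = 0 := by
        apply mul_left_cancel₀ hC0
        linear_combination hHp
      rw [zero_add] at hhA
      subst hhA
      rcases S.leading_finite_of_pole hδ he hγ hq1 hq2 hH hp1 hp2
        (by linear_combination hC) with h | h | h
      · exact ⟨0, 1, 2, by simp, by simp [h], by simp⟩
      · exact ⟨0, 4, 2, by simp, by simp [h], by simp⟩
      · exact ⟨0, -1, 2, by simp, by simp [h], by simp⟩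
  subst hC0
  by_cases hD0 : D = 0
  swap
  · have hhB : h = B + P.T := by
      linear_combination ((mul_eq_zero.1 hDS).resolve_left hD0) / 2
    obtain rfl : B = 0 := by
      apply mul_left_cancel₀ hD0
      linear_combination hHp
    rw [zero_add] at hhB
    subst hhB
    rcases S.symm.leading_finite_of_pole hδ he hγ hq2 hq1 hH hp2 hp1
      (by linear_combination hD) with h | h | h
    · exact ⟨1, 0, 2, by simp [h], by simp, by simp⟩
    · exact ⟨4, 0, 2, by simp [h], by simp, by simp⟩
    · exact ⟨-1, 0, 2, by simp [h], by simp, by simp⟩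
  subst hD0
  obtain ⟨C, hp1⟩ := hp1.pred (l := 1) rfl
  obtain ⟨D, hp2⟩ := hp2.pred (l := 1) rfl
  have hA : A = 0 ∨ A = 2 * h + P.T := by
    rcases mul_eq_zero.1 (show A * (A - 2 * h - P.T) = 0 by linear_combination -hD) with h | h
    · exact Or.inl h
    · exact Or.inr (by linear_combination h)
  have hB : B = 0 ∨ B = 2 * h + P.T := by
    rcases mul_eq_zero.1 (show B * (B - 2 * h - P.T) = 0 by linear_combination -hC) with h | h
    · exact Or.inl h
    · exact Or.inr (by linear_combination h)
  have hHp := ((hq1.mul hp1).add (hq2.mul hp2)).congr S.eq_H.symm |>.unique (hH.lift (l := 2))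
  have hCS := hpS zero_le_one hq1 hp1 S.eq_p₁
  have hDS := hpS zero_le_one hq2 hp2 S.eq_p₂
  push_cast at hCS hDS
  by_cases hC0 : C = 0
  swap
  · have hhA : 2 * h = 2 * A + P.T := by
      linear_combination (mul_eq_zero.1 hCS).resolve_left hC0
    rcases hA with rfl | hA
    · rcases hB with rfl | hB
      · exact ⟨0, 0, 1, by simp, by simp, by simp [hhA]⟩
      · exact ⟨0, 2, 1, by simp, by rw [hB, hhA]; push_cast; ring, by simp [hhA]⟩
    · have hA' : A = -2 * P.T := by linear_combination -hA - hhA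
      have hh : 2 * h = -3 * P.T := by linear_combination hhA + 2 * hA'
      rcases hB with rfl | hB
      · exact ⟨-2, 0, -3, by simp [hA'], by simp, by simp [hh]⟩
      · exact ⟨-2, -2, -3, by simp [hA'], by rw [hB, hh]; push_cast; ring, by simp [hh]⟩
  by_cases hD0 : D = 0
  swap
  · have hhB : 2 * h = 2 * B + P.T := by
      linear_combination (mul_eq_zero.1 hDS).resolve_left hD0
    rcases hB with rfl | hB
    · rcases hA with rfl | hA
      · exact ⟨0, 0, 1, by simp, by simp, by simp [hhB]⟩
      · exact ⟨2, 0, 1, by rw [hA, hhB]; push_cast; ring, by simp, by simp [hhB]⟩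
    · have hB' : B = -2 * P.T := by linear_combination -hB - hhB
      have hh : 2 * h = -3 * P.T := by linear_combination hhB + 2 * hB'
      rcases hA with rfl | hA
      · exact ⟨0, -2, -3, by simp, by simp [hB'], by simp [hh]⟩
      · exact ⟨-2, -2, -3, by rw [hA, hh]; push_cast; ring, by simp [hB'], by simp [hh]⟩
  subst hC0 hD0
  obtain ⟨C, hp1⟩ := hp1.pred (l := 0) rfl
  obtain ⟨D, hp2⟩ := hp2.pred (l := 0) rfl
  have hHp := ((hq1.mul hp1).add (hq2.mul hp2)).congr S.eq_H.symm |>.unique hH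
  have hCS := hpS le_rfl hq1 hp1 S.eq_p₁
  have hDS := hpS le_rfl hq2 hp2 S.eq_p₂
  push_cast at hCS hDS
  have hCS' : C = 0 ∨ h = A := (mul_eq_zero.1 hCS).imp id (fun h => by linear_combination h / 2)
  have hDS' : D = 0 ∨ h = B := (mul_eq_zero.1 hDS).imp id (fun h => by linear_combination h / 2)
  -- Both p's are regular now. If h ≠ 0, one product qᵢpᵢ contributes to it; for that index h = z
  -- and z = 2h + T, so h = −T.
  have hres : h = 0 ∨ h = -P.T := by
    by_cases hAC : A * C = 0
    · by_cases hBD : B * D = 0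
      · exact Or.inl (by linear_combination -hHp + hAC + hBD)
      · have h1 := hDS'.resolve_left (right_ne_zero_of_mul hBD)
        have h2 := hB.resolve_left (left_ne_zero_of_mul hBD)
        exact Or.inr (by linear_combination -h1 - h2)
    · have h1 := hCS'.resolve_left (right_ne_zero_of_mul hAC)
      have h2 := hA.resolve_left (left_ne_zero_of_mul hAC)
      exact Or.inr (by linear_combination -h1 - h2)
  have hint : ∀ {z : ℂ}, z = 0 ∨ z = 2 * h + P.T → ∃ i : ℤ, z = i * P.T := by
    rintro z (rfl | rfl)
    · exact ⟨0, by simp⟩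
    · rcases hres with h | h
      · exact ⟨1, by simp [h]⟩
      · exact ⟨-1, by rw [h]; push_cast; ring⟩
  obtain ⟨i, hi⟩ := hint hA
  obtain ⟨j, hj⟩ := hint hB
  rcases hres with h | h
  · exact ⟨i, j, 0, hi, hj, by simp [h]⟩
  · exact ⟨i, j, -2, hi, hj, by rw [h]; push_cast; ring⟩

/-! ### Values at infinity and at zero -/

/-- At ∞ the terms −t and 4tpᵢ of the q-equations must cancel, so p₁ and p₂ both take the value 1/4.
The p-equations and the definition of H then form a linear system for the three values. -/
theorem value_infinity (S : HSystem q₁ p₁ q₂ p₂ H a b₁ b₂) (hδ : P.δ = 0) (he : P.e = 1)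
    (hT : P.T = 1) : P.E 0 q₁ (a - 3 * b₁ - b₂) ∧ P.E 0 q₂ (a - b₁ - 3 * b₂) ∧
      P.E 0 H ((a - 2 * b₁ - 2 * b₂) / 2) := by
  have ht : P.E 1 t 1 := hT ▸ he ▸ E_t
  obtain ⟨x, y, h, hq1, hq2, hH⟩ := S.exists_E P
  rw [hδ] at hq1 hq2 hH
  have hp : ∀ {q p : RatFunc ℂ} {z : ℂ}, P.E 0 q z →
      t * ratDeriv q = 2 * (q * H) - q * q + const a * q - t + 4 * (t * p) →
      P.E 0 p (1 / 4) := by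
    intro q p z hq hS
    have h1 := ((((hq.deriv (n := 0)).sub (hq.mul hH).two_mul).add (hq.mul hq)).sub
      (hq.const_mul a)).lift.add ht
    have h2 := h1.congr (g := t * (4 * p)) (by linear_combination hS)
    have h3 := (ht.cancel one_ne_zero h2 (l := 0)).const_mul (1 / 4)
    rw [zero_add, div_one, mul_one] at h3
    exact h3.congr (by rw [const, map_div₀, map_one, map_ofNat]; ring)
  have hpS : ∀ {q p : RatFunc ℂ} {b z : ℂ}, P.E 0 q z → P.E 0 p (1 / 4) →
      t * ratDeriv p = const b - const a * p - p * (2 * (H - q)) →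
      b - a / 4 - (h - z) / 2 = 0 := by
    intro q p b z hq hp hS
    have h1 := (((E_const b).sub (hp.const_mul a)).sub
      (hp.mul (hH.sub hq).two_mul (n := 0))).congr hS.symm |>.unique (hp.deriv)
    push_cast at h1
    linear_combination h1
  have hp2 := hp hq1 S.eq_q₁
  have hp1 := hp hq2 S.eq_q₂
  have hHp := ((hq1.mul hp1).add (hq2.mul hp2)).congr S.eq_H.symm |>.unique hH
  have hC := hpS hq1 hp1 S.eq_p₁
  have hD := hpS hq2 hp2 S.eq_p₂
  have hx : a - 3 * b₁ - b₂ = x := by linear_combination -3 * hC - hD + 2 * hHp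
  have hy : a - b₁ - 3 * b₂ = y := by linear_combination -hC - 3 * hD + 2 * hHp
  have hh : (a - 2 * b₁ - 2 * b₂) / 2 = h := by linear_combination hHp + hx / 4 + hy / 4
  rw [hx, hy, hh]
  exact ⟨hq1, hq2, hH⟩

/-- The leading terms at a pole of p₁ do not determine q₂(0). With q₁ = xt + ⋯, the coefficient of t
in the q₁-equation gives p₂(0) = 1/4, and the constant term of the p₂-equation then gives y. -/
theorem value_zero_of_pole (S : HSystem q₁ p₁ q₂ p₂ H a b₁ b₂) (hδ : P.δ = 0) (he : P.e = -1)
    (hγ : P.γ = 1) (hT : P.T = 1) (hq1 : P.E 0 q₁ 0) (hq2 : P.E 0 q₂ y) (hH : P.E 0 H h)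
    (hp2 : P.E 1 p₂ 0) (hh : 2 * h + a = 1) : y = 1 / 2 - 2 * b₂ := by
  have ht : P.E (-1) t 1 := hT ▸ he ▸ E_t
  obtain ⟨x, hq1⟩ := hq1.pred (l := -1) rfl
  obtain ⟨d, hp2⟩ := hp2.pred (l := 0) rfl
  have e1 := ((((((hq1.mul hH (n := -1)).two_mul).sub (hq1.mul hq1 rfl).lift).add
    (hq1.const_mul a)).sub ht).add (ht.mul hp2).four_mul).congr S.eq_q₁.symm
    |>.unique (hq1.deriv)
  have e2 := (((E_const b₂).sub (hp2.const_mul a)).sub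
      (hp2.mul (hH.sub hq2).two_mul (n := 0))).congr S.eq_p₂.symm |>.unique (hp2.deriv)
  rw [hγ] at e1 e2
  push_cast at e1 e2
  have hd : d = 1 / 4 := by linear_combination (e1 - x * hh) / 4
  rw [hd] at e2
  linear_combination 2 * e2 + hh / 2

/-- The q-equations allow p₁ and p₂ at most simple poles at 0. An actual pole leads to the last two
cases. Otherwise each qᵢ(0) is 0 or 2h + a, and the p-equations express h through b₁ and b₂, which
gives the first four. -/
theorem value_zero (S : HSystem q₁ p₁ q₂ p₂ H a b₁ b₂) (hδ : P.δ = 0) (he : P.e = -1)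
    (hγ : P.γ = 1) (hT : P.T = 1) : ∃ x y h, P.E 0 q₁ x ∧ P.E 0 q₂ y ∧ P.E 0 H h ∧
      ((x = 0 ∧ y = 0 ∧ h = 0) ∨ (x = 0 ∧ y = a - 2 * b₂) ∨ (x = a - 2 * b₁ ∧ y = 0) ∨
        (x = a - 2 * (b₁ + b₂) ∧ y = a - 2 * (b₁ + b₂) ∧ h = -(b₁ + b₂)) ∨
        (x = 0 ∧ y = 1 / 2 - 2 * b₂) ∨ (x = 1 / 2 - 2 * b₁ ∧ y = 0)) := by
  have ht : P.E (-1) t 1 := hT ▸ he ▸ E_t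
  obtain ⟨x, y, h, hq1, hq2, hH⟩ := S.exists_E P
  rw [hδ] at hq1 hq2 hH
  refine ⟨x, y, h, hq1, hq2, hH, ?_⟩
  have hp : ∀ {q p : RatFunc ℂ} {z : ℂ}, P.E 0 q z →
      t * ratDeriv q = 2 * (q * H) - q * q + const a * q - t + 4 * (t * p) →
      ∃ d, P.E 1 p d ∧ 4 * d = z * z - 2 * z * h - a * z := by
    intro q p z hq hS
    have h1 := ((((hq.deriv (n := 0)).sub (hq.mul hH).two_mul).add (hq.mul hq)).sub
      (hq.const_mul a)).add ht.lift
    have h2 := h1.congr (g := 4 * t * p) (by linear_combination hS)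
    have h3 := ht.four_mul.cancel (by norm_num) h2 (l := 1)
    refine ⟨_, h3, ?_⟩
    push_cast
    ring
  obtain ⟨D, hp2, hD⟩ := hp hq1 S.eq_q₁
  obtain ⟨C, hp1, hC⟩ := hp hq2 S.eq_q₂
  have hpS : ∀ {q p : RatFunc ℂ} {b z d : ℂ}, P.E 0 q z → P.E 1 p d →
      t * ratDeriv p = const b - const a * p - p * (2 * (H - q)) →
      d * (2 * (h - z) + a - 1) = 0 := by
    intro q p b z d hq hp hS
    have h1 := ((((E_const b).lift).sub (hp.const_mul a)).sub
      (hp.mul (hH.sub hq).two_mul (n := 1))).congr hS.symm |>.unique (hp.deriv)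
    rw [hγ] at h1
    push_cast at h1
    linear_combination -h1
  have hCS := hpS hq1 hp1 S.eq_p₁
  have hDS := hpS hq2 hp2 S.eq_p₂
  have hHp := ((hq1.mul hp1).add (hq2.mul hp2)).congr S.eq_H.symm |>.unique (hH.lift (l := 1))
  by_cases hC0 : C = 0
  swap
  · have hhx := (mul_eq_zero.1 hCS).resolve_left hC0
    by_cases hD0 : D = 0
    · subst hD0
      obtain rfl : x = 0 := by
        apply mul_left_cancel₀ hC0
        linear_combination hHp
      have := S.value_zero_of_pole hδ he hγ hT hq1 hq2 hH hp2 (by linear_combination hhx)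
      tauto
    · exfalso
      have hhy := (mul_eq_zero.1 hDS).resolve_left hD0
      obtain rfl : x = y := by linear_combination (hhy - hhx) / 2
      obtain rfl : C = D := by linear_combination (hC - hD) / 4
      have hx : x = 0 := by
        apply mul_left_cancel₀ hC0
        linear_combination hHp / 2
      rw [hx] at hC
      exact hC0 (by linear_combination hC / 4)
  subst hC0
  by_cases hD0 : D = 0
  swap
  · have hhy := (mul_eq_zero.1 hDS).resolve_left hD0
    obtain rfl : y = 0 := by
      apply mul_left_cancel₀ hD0
      linear_combination hHp
    have := S.symm.value_zero_of_pole hδ he hγ hT hq2 hq1 hH hp1 (by linear_combination hhy)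
    tauto
  subst hD0
  obtain ⟨C, hp1⟩ := hp1.pred (l := 0) rfl
  obtain ⟨D, hp2⟩ := hp2.pred (l := 0) rfl
  have hHp := ((hq1.mul hp1).add (hq2.mul hp2)).congr S.eq_H.symm |>.unique hH
  have hpS : ∀ {q p : RatFunc ℂ} {b z d : ℂ}, P.E 0 q z → P.E 0 p d →
      t * ratDeriv p = const b - const a * p - p * (2 * (H - q)) →
      b = d * (2 * (h - z) + a) := by
    intro q p b z d hq hp hS
    have h1 := (((E_const b).sub (hp.const_mul a)).sub
      (hp.mul (hH.sub hq).two_mul (n := 0))).congr hS.symm |>.unique (hp.deriv)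
    push_cast at h1
    linear_combination h1
  have hCS := hpS hq1 hp1 S.eq_p₁
  have hDS := hpS hq2 hp2 S.eq_p₂
  rcases mul_eq_zero.1 (show x * (x - 2 * h - a) = 0 by linear_combination -hD) with rfl | hx <;>
    rcases mul_eq_zero.1 (show y * (y - 2 * h - a) = 0 by linear_combination -hC) with rfl | hy
  · exact Or.inl ⟨rfl, rfl, by linear_combination -hHp⟩
  · exact Or.inr (Or.inl ⟨rfl, by linear_combination hy + 2 * hDS - 2 * D * hy - 2 * hHp⟩)
  · exact Or.inr (Or.inr (Or.inl ⟨by linear_combination hx + 2 * hCS - 2 * C * hx - 2 * hHp, rfl⟩))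
  · have hh : h = -(b₁ + b₂) := by linear_combination hCS + hDS - C * hx - D * hy - hHp
    exact Or.inr (Or.inr (Or.inr (Or.inl ⟨by linear_combination hx + 2 * hh,
      by linear_combination hy + 2 * hh, hh⟩)))

end HSystem

/-! ### Rational functions with simple poles -/

theorem ValueAt.sub {c z w : ℂ} {f g : RatFunc ℂ} (hf : ValueAt c f z) (hg : ValueAt c g w) :
    ValueAt c (f - g) (z - w) := by
  have h := hf.add ((ValueAt.of_const (-1)).mul hg)
  convert h using 1
  · rw [const, map_neg, map_one]; ring
  · ring

theorem ValueAt.sum {ι : Type*} (s : Finset ι) {c : ℂ} {f : ι → RatFunc ℂ} {z : ι → ℂ}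
    (h : ∀ i ∈ s, ValueAt c (f i) (z i)) : ValueAt c (∑ i ∈ s, f i) (∑ i ∈ s, z i) := by
  classical
  induction s using Finset.induction_on with
  | empty => simpa using ValueAt.of_const (c := c) 0
  | insert i s hi ih =>
    rw [Finset.sum_insert hi, Finset.sum_insert hi]
    exact (h i (by simp)).add (ih fun j hj => h j (by simp [hj]))

theorem ValueAtInfinity.sum {ι : Type*} (s : Finset ι) {f : ι → RatFunc ℂ} {z : ι → ℂ}
    (h : ∀ i ∈ s, ValueAtInfinity (f i) (z i)) :
    ValueAtInfinity (∑ i ∈ s, f i) (∑ i ∈ s, z i) := by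
  classical
  induction s using Finset.induction_on with
  | empty => simpa using ValueAtInfinity.of_const 0
  | insert i s hi ih =>
    rw [Finset.sum_insert hi, Finset.sum_insert hi]
    exact (h i (by simp)).add (ih fun j hj => h j (by simp [hj]))

theorem t_sub_const_eq (c : ℂ) :
    t - const c = algebraMap ℂ[X] (RatFunc ℂ) (X - Polynomial.C c) := by
  rw [map_sub, RatFunc.algebraMap_X, RatFunc.algebraMap_C]

theorem ValueAt.of_const_div {c d : ℂ} (h : c ≠ d) (a : ℂ) :
    ValueAt c (const a / (t - const d)) (a / (c - d)) := by
  have h' : c - d ≠ 0 := sub_ne_zero.2 h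
  refine ⟨Polynomial.C a, X - Polynomial.C d, by simpa using h', ?_, ?_⟩
  · rw [t_sub_const_eq, RatFunc.algebraMap_C]
  · simp only [eval_C, eval_sub, eval_X]
    field_simp

theorem ValueAtInfinity.of_const_div (a d : ℂ) :
    ValueAtInfinity (const a / (t - const d)) 0 := by
  refine ⟨Polynomial.C a, X - Polynomial.C d, 1, by simp, by simp, by simp, ?_, ?_⟩
  · rw [t_sub_const_eq, RatFunc.algebraMap_C]
  · simp

theorem valueAt_of_denom {c : ℂ} {f : RatFunc ℂ} (h : f.denom.eval c ≠ 0) :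
    ∃ z, ValueAt c f z :=
  ⟨f.num.eval c / f.denom.eval c, f.num, f.denom, h, (RatFunc.num_div_denom f).symm,
    by field_simp⟩

theorem ValueAt.denom_ne_zero {c z : ℂ} {f : RatFunc ℂ} (h : ValueAt c f z) :
    f.denom.eval c ≠ 0 := by
  obtain ⟨N, D, hD, rfl, -⟩ := h
  intro h0
  obtain ⟨M, hM⟩ := RatFunc.denom_div_dvd N D
  apply hD
  rw [hM, eval_mul, h0, zero_mul]

/-- A rational function without poles on the Riemann sphere is constant. -/
theorem eq_const_of_regular {f : RatFunc ℂ} {w : ℂ} (h : ∀ c, ∃ z, ValueAt c f z)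
    (hw : ValueAtInfinity f w) : f = const w := by
  have hdeg : f.denom.degree = 0 := by
    by_contra hd
    obtain ⟨c, hc⟩ := IsAlgClosed.exists_root f.denom hd
    obtain ⟨z, hz⟩ := h c
    exact hz.denom_ne_zero hc
  have hden : f.denom = 1 :=
    (Polynomial.Monic.natDegree_eq_zero (RatFunc.monic_denom f)).1
      (natDegree_eq_of_degree_eq_some hdeg)
  have hf : f = algebraMap ℂ[X] (RatFunc ℂ) f.num / algebraMap ℂ[X] (RatFunc ℂ) 1 := by
    rw [← hden, RatFunc.num_div_denom]
  obtain ⟨N, D, n, hD, h1, h2, he, -⟩ := id hw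
  have hD0 := ValueAtInfinity.ne_zero_of_coeff hD
  have key := mul_eq_mul_of_div_eq_div one_ne_zero hD0 (hf.symm.trans he)
  rw [mul_one] at key
  have hn : D.natDegree = n := le_antisymm h2 (le_natDegree_of_ne_zero hD)
  have hnum : f.num.natDegree = 0 := by
    by_cases h0 : f.num = 0
    · rw [h0, natDegree_zero]
    · have h3 := natDegree_mul h0 hD0
      rw [key] at h3
      omega
  rw [eq_C_of_natDegree_eq_zero hnum, map_one, div_one, RatFunc.algebraMap_C] at hf
  rw [hf] at hw ⊢
  rw [(ValueAtInfinity.of_const _).unique hw]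

/-- If `f` is regular at `0` and `∞`, and its other poles are simple with integral residues with
respect to `dt / t`, then `f` takes values at `0` and `∞` that differ by an integer. -/
theorem exists_int_sub_eq {f : RatFunc ℂ} {z w : ℂ}
    (hf : ∀ c (hc : c ≠ 0), ∃ n : ℤ, (finitePlace c hc).E 1 f (n * c))
    (hz : ValueAt 0 f z) (hw : ValueAtInfinity f w) : ∃ n : ℤ, w - z = n := by
  classical
  choose! N hN using fun (c : {c : ℂ // c ≠ 0}) => hf c c.2
  -- The value at c = 0 is never used, since 0 is not a pole of `f`.
  let n : ℂ → ℤ := fun c => if hc : c ≠ 0 then N ⟨c, hc⟩ else 0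
  have hn : ∀ c (hc : c ≠ 0), (finitePlace c hc).E 1 f (n c * c) := by
    intro c hc
    simpa [n, hc] using hN ⟨c, hc⟩
  set s := f.denom.roots.toFinset with hs
  have hs' : ∀ c, c ∈ s ↔ f.denom.eval c = 0 := by
    intro c
    simp [hs, RatFunc.denom_ne_zero]
  have h0 : (0 : ℂ) ∉ s := fun h => hz.denom_ne_zero ((hs' 0).1 h)
  -- Subtracting all principal parts leaves a function without poles, hence the constant `w`; at 0
  -- the principal part at c has the value −n c.
  set g := f - ∑ c ∈ s, const (n c * c) / (t - const c) with hg
  have hval : ∀ (c : ℂ) (s' : Finset ℂ), c ∉ s' →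
      ValueAt c (∑ d ∈ s', const (n d * d) / (t - const d)) (∑ d ∈ s', n d * d / (c - d)) := by
    intro c s' hc
    refine ValueAt.sum s' fun d hd => ValueAt.of_const_div ?_ _
    rintro rfl
    exact hc hd
  have hreg : ∀ c, ∃ z, ValueAt c g z := by
    intro c
    by_cases hc : c ∈ s
    · have hc0 : c ≠ 0 := by rintro rfl; exact h0 hc
      have h1 : ValueAt c ((t - const c) ^ (1 : ℤ) * f) (n c * c) := hn c hc0
      have h2 := h1.sub (ValueAt.of_const (n c * c))
      rw [sub_self] at h2
      obtain ⟨z', h3⟩ := h2.div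
      have h4 := h3.sub (hval c (s.erase c) (Finset.notMem_erase c s))
      have h5 := ValueAt.sub_const_ne_zero c
      rw [zpow_one, sub_div, mul_div_cancel_left₀ _ h5, sub_sub,
        Finset.add_sum_erase s (fun c => const (n c * c) / (t - const c)) hc] at h4
      exact ⟨_, h4⟩
    · obtain ⟨z', hz'⟩ := valueAt_of_denom (fun h => hc ((hs' c).2 h))
      exact ⟨_, hz'.sub (hval c s hc)⟩
  have hinf : ValueAtInfinity g w := by
    have h1 := ValueAtInfinity.sum s (f := fun c => const (n c * c) / (t - const c))
      (z := fun _ => 0) fun c _ => ValueAtInfinity.of_const_div _ _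
    have h2 := hw.add ((ValueAtInfinity.of_const (-1)).mul h1)
    convert h2 using 1
    · rw [hg, const, map_neg, map_one]; ring
    · simp
  have h1 := hz.sub (hval 0 s h0)
  rw [← hg, eq_const_of_regular hreg hinf] at h1
  have h2 := (ValueAt.of_const w).unique h1
  refine ⟨∑ c ∈ s, n c, ?_⟩
  have h3 : ∑ d ∈ s, (n d : ℂ) * d / (0 - d) = -∑ d ∈ s, (n d : ℂ) := by
    rw [← Finset.sum_neg_distrib]
    refine Finset.sum_congr rfl fun d hd => ?_
    have hd0 : d ≠ 0 := by rintro rfl; exact h0 hd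
    field_simp
    ring
  rw [h2, h3]
  push_cast
  ring

/-! ### The parameters of rational solutions -/

theorem IsRationalSolution.hSystem {x : State} (hx : IsRationalSolution x) :
    HSystem x.q₁ x.p₁ x.q₂ x.p₂ (x.q₁ * x.p₁ + x.q₂ * x.p₂) (x.α₀ + x.α₁ + x.α₃) x.α₀ x.α₁ where
  eq_H := rfl
  eq_q₁ := by rw [hx.eq_q₁]; ring
  eq_p₁ := by rw [hx.eq_p₁]; ring
  eq_q₂ := by rw [hx.eq_q₂]; ring
  eq_p₂ := by rw [hx.eq_p₂]; ring

/-- Here `y`, `z`, `h` are the values of q₁, q₂, H at 0; the three integers are the differences of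
the values of q₁, q₂, 2H at ∞ and 0. -/
theorem IsRationalSolution.params {x : State} (hx : IsRationalSolution x) :
    ∃ (y z h : ℂ) (i j k : ℤ), x.α₃ - 2 * x.α₀ - y = i ∧ x.α₃ - 2 * x.α₁ - z = j ∧
      x.α₃ - x.α₀ - x.α₁ - 2 * h = k ∧
      ((y = 0 ∧ z = 0 ∧ h = 0) ∨ (y = 0 ∧ z = x.α₀ - x.α₁ + x.α₃) ∨
        (y = x.α₁ - x.α₀ + x.α₃ ∧ z = 0) ∨
        (y = x.α₃ - x.α₀ - x.α₁ ∧ z = x.α₃ - x.α₀ - x.α₁ ∧ h = -(x.α₀ + x.α₁)) ∨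
        (y = 0 ∧ z = 1 / 2 - 2 * x.α₁) ∨ (y = 1 / 2 - 2 * x.α₀ ∧ z = 0)) := by
  have S := hx.hSystem
  have regular : ∀ {f : RatFunc ℂ} {z : ℂ}, zeroPlace.E 0 f z → ValueAt 0 f z := by
    intro f z h
    have h' : ValueAt 0 ((t - const 0) ^ (0 : ℤ) * f) z := h
    rwa [zpow_zero, one_mul] at h'
  have regular' : ∀ {f : RatFunc ℂ} {z : ℂ}, infinitePlace.E 0 f z → ValueAtInfinity f z := by
    intro f z h
    have h' : ValueAtInfinity (t⁻¹ ^ (0 : ℤ) * f) z := h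
    rwa [zpow_zero, one_mul] at h'
  obtain ⟨y, z, h, hy, hz, hh, hcases⟩ := S.value_zero (P := zeroPlace) rfl rfl rfl rfl
  obtain ⟨hy', hz', hh'⟩ := S.value_infinity (P := infinitePlace) rfl rfl rfl
  have hfin := fun c hc => S.leading_finite (P := finitePlace c hc) rfl rfl rfl
  obtain ⟨i, hi⟩ := exists_int_sub_eq (fun c hc => by
    obtain ⟨i, j, k, h1, h2, h3⟩ := hfin c hc
    exact ⟨i, h1⟩) (regular hy) (regular' hy')
  obtain ⟨j, hj⟩ := exists_int_sub_eq (fun c hc => by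
    obtain ⟨i, j, k, h1, h2, h3⟩ := hfin c hc
    exact ⟨j, h2⟩) (regular hz) (regular' hz')
  obtain ⟨k, hk⟩ := exists_int_sub_eq (fun c hc => by
    obtain ⟨i, j, k, h1, h2, h3⟩ := hfin c hc
    exact ⟨k, h3⟩) (regular hh.two_mul) (regular' hh'.two_mul)
  refine ⟨y, z, h, i, j, k, ?_, ?_, ?_, ?_⟩
  · linear_combination hi
  · linear_combination hj
  · linear_combination hk
  · rcases hcases with h | ⟨h1, h2⟩ | ⟨h1, h2⟩ | ⟨h1, h2, h3⟩ | h | h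
    · exact Or.inl h
    · exact Or.inr (Or.inl ⟨h1, by rw [h2]; ring⟩)
    · exact Or.inr (Or.inr (Or.inl ⟨by rw [h1]; ring, h2⟩))
    · exact Or.inr (Or.inr (Or.inr (Or.inl ⟨by rw [h1]; ring, by rw [h2]; ring, h3⟩)))
    · tauto
    · tauto

/-- Some Bäcklund transformation makes `-2α₀ + α₃` and `-2α₁ + α₃` integers of the same parity. -/
theorem exists_act_even_sub {x : State} (hx : IsRationalSolution x) :
    ∃ (w : List Generator) (m n : ℤ), -2 * (act w x).α₀ + (act w x).α₃ = m ∧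
      -2 * (act w x).α₁ + (act w x).α₃ = n ∧ Even (m - n) := by
  have h5 := hx.normalization
  obtain ⟨y, z, h, i, j, k, hi, hj, hk, hcases⟩ := hx.params
  rcases hcases with ⟨rfl, rfl, rfl⟩ | ⟨rfl, rfl⟩ | ⟨rfl, rfl⟩ | ⟨rfl, rfl, rfl⟩ | ⟨rfl, rfl⟩ |
    ⟨rfl, rfl⟩
  · refine ⟨[], i, j, ?_, ?_, ⟨k - j, ?_⟩⟩
    · change -2 * x.α₀ + x.α₃ = i
      linear_combination hi
    · change -2 * x.α₁ + x.α₃ = j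
      linear_combination hj
    -- The parity comes from the residues of 2H: here i + j = 2k.
    · have : (i : ℂ) - j = k - j + (k - j) := by linear_combination 2 * hk - hi - hj
      exact_mod_cast this
  -- Now i = α₃ − 2α₀ and j = −α₀ − α₁, and s₁ turns α₃ − 2α₁ into α₃ + 2α₁ = i − 2j.
  · refine ⟨[.s1], i, i - 2 * j, ?_, ?_, ⟨j, by ring⟩⟩
    · change -2 * (s₁ x).α₀ + (s₁ x).α₃ = _
      simp only [hx.params_s₁]
      linear_combination hi
    · change -2 * (s₁ x).α₁ + (s₁ x).α₃ = _
      simp only [hx.params_s₁]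
      push_cast
      linear_combination hi - 2 * hj
  · refine ⟨[.s0], j - 2 * i, j, ?_, ?_, ⟨-i, by ring⟩⟩
    · change -2 * (s₀ x).α₀ + (s₀ x).α₃ = _
      simp only [hx.params_s₀]
      push_cast
      linear_combination hj - 2 * hi
    · change -2 * (s₀ x).α₁ + (s₀ x).α₃ = _
      simp only [hx.params_s₀]
      linear_combination hj
  -- Now i = −j = α₁ − α₀ and k = α₀ + α₁ + α₃, so changing the sign of α₃ gives i − k and j − k.
  · refine ⟨[.s3], i - k, j - k, ?_, ?_, ⟨i, ?_⟩⟩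
    · change -2 * (s₃ x).α₀ + (s₃ x).α₃ = _
      simp only [hx.params_s₃]
      push_cast
      linear_combination hi - hk
    · change -2 * (s₃ x).α₁ + (s₃ x).α₃ = _
      simp only [hx.params_s₃]
      push_cast
      linear_combination hj - hk
    · have : (i : ℂ) - k - (j - k) = i + i := by linear_combination hi + hj
      exact_mod_cast this
  -- s₂ fixes α₃ − 2α₀ and α₃ − 2α₁, and by the normalization 1/2 − 2α₁ is the value of α₀ − α₁ + α₃
  -- after s₂. This is therefore the s₁ case applied after s₂; the last case is its mirror image.
  · refine ⟨[.s1, .s2], i, i - 2 * j, ?_, ?_, ⟨j, by ring⟩⟩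
    · change -2 * (s₁ (s₂ x)).α₀ + (s₁ (s₂ x)).α₃ = _
      simp only [hx.s₂.params_s₁, hx.params_s₂]
      linear_combination hi
    · change -2 * (s₁ (s₂ x)).α₁ + (s₁ (s₂ x)).α₃ = _
      simp only [hx.s₂.params_s₁, hx.params_s₂]
      push_cast
      linear_combination hi - 2 * hj + 2 * h5
  · refine ⟨[.s0, .s2], j - 2 * i, j, ?_, ?_, ⟨-i, by ring⟩⟩
    · change -2 * (s₀ (s₂ x)).α₀ + (s₀ (s₂ x)).α₃ = _
      simp only [hx.s₂.params_s₀, hx.params_s₂]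
      push_cast
      linear_combination hj - 2 * hi + 2 * h5
    · change -2 * (s₀ (s₂ x)).α₁ + (s₀ (s₂ x)).α₃ = _
      simp only [hx.s₂.params_s₀, hx.params_s₂]
      linear_combination hj

end Sasano

theorem mainTheorem6 (x : Sasano.State) (hx : Sasano.IsRationalSolution x) :
    (∃ w : List Sasano.Generator,
      Sasano.IsRationalSolution (Sasano.act w x) ∧
      (∃ m : ℤ, -2 * (Sasano.act w x).α₀ + (Sasano.act w x).α₃ = m) ∧
      (∃ n : ℤ, -2 * (Sasano.act w x).α₁ + (Sasano.act w x).α₃ = n) ∧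
      ∃ v : List Sasano.Shift,
        Sasano.IsRationalSolution (Sasano.shiftAct v (Sasano.act w x)) ∧
        -2 * (Sasano.shiftAct v (Sasano.act w x)).α₀
          + (Sasano.shiftAct v (Sasano.act w x)).α₃ = 0 ∧
        -2 * (Sasano.shiftAct v (Sasano.act w x)).α₁
          + (Sasano.shiftAct v (Sasano.act w x)).α₃ = 0) ∧
    (∀ (w : List Sasano.Generator) (m n : ℤ),
      -2 * (Sasano.act w x).α₀ + (Sasano.act w x).α₃ = m →
      -2 * (Sasano.act w x).α₁ + (Sasano.act w x).α₃ = n →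
      Even (m - n) →
      ∃ v : List Sasano.Shift,
        Sasano.IsRationalSolution (Sasano.shiftAct v (Sasano.act w x)) ∧
        -2 * (Sasano.shiftAct v (Sasano.act w x)).α₀
          + (Sasano.shiftAct v (Sasano.act w x)).α₃ = 0 ∧
        -2 * (Sasano.shiftAct v (Sasano.act w x)).α₁
          + (Sasano.shiftAct v (Sasano.act w x)).α₃ = 0) := by
  refine ⟨?_, fun w m n hm hn hmn =>
    Sasano.exists_shiftAct_eq_zero (hx.act w) hm hn hmn⟩
  obtain ⟨w, m, n, hm, hn, hmn⟩ := Sasano.exists_act_even_sub hx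
  exact ⟨w, hx.act w, ⟨m, hm⟩, ⟨n, hn⟩, Sasano.exists_shiftAct_eq_zero (hx.act w) hm hn hmn⟩
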